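/- Let $n\ge 1$ and let $H$ be an $n$-dimensional Hamiltonian, that is, a (possibly unbounded) self-adjoint operator on an infinite-dimensional separable complex Hilbert space $\mathcal H$, considered as a quantum system with $n$ degrees of freedom. If the spectrum of $H$ is countable, then: 1. $H$ has pure point spectrum: if $E$ is the spectral resolution of $H$ and $\mathcal H_{\mathrm{cont}}$ is the subspace of all $\psi\in\mathcal H$ whose spectral measure $\mu_\psi(\cdot)=\|E(\cdot)\psi\|^2$ has no atoms, then $\sigma_{\mathrm{cont}}(H):=\sigma(H|_{\mathcal H_{\mathrm{cont}}})=\emptyset$. 2. $H$ is integrable with self-adjoint commuting first integrals: there are $n$ self-adjoint operators $T_1,\dots,T_n$ on $\mathcal H$ which commute with each other and with $H$ (all spectral projections commute) and are functionally independent (no $T_i$ is a Borel function of the operators $T_j$, $j\ne i$), and a unitary map $U:\mathcal H\to L^2(\mathbb R^n)$ such that $A=UHU^{-1}$ and $N_i=UT_iU^{-1}$ are smooth functions $A=a(X,P)$, $N_i=t_i(X,P)$ of the position and momentum operators $X_j\psi=x_j\psi$, $P_j\psi=-\mathrm i\,\partial_j\psi$. Here $a,t_1,\dots,t_n\in C^\infty(\mathbb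 R^{2n},\mathbb R)$ form a classically (Liouville) integrable system: $\{a,t_i\}=\{t_i,t_j\}=0$ for all $i,j$, and $dt_1,\dots,dt_n$ are linearly independent on a dense subset of $\mathbb R^{2n}$. The relation "the self-adjoint operator $A$ is the smooth function $a(X,P)$" is the smallest one such that: (i) if the symmetrized polynomial $q(X,P)$, with $q$ a real polynomial, is essentially self-adjoint on the Schwartz space, its closure is $q(X,P)$; (ii) if $T_j=t_j(X,P)$, $j=1,\dots,k$, have a joint spectral resolution and $f\in C^\infty(\mathbb R^k,\mathbb R)$, then $f(T_1,\dots,T_k)$, defined by the joint functional calculus, is $f(t_1,\dots,t_k)(X,P)$; (iii) if $A=a(X,P)$, $B=b(X,P)$ and $A+B$ has a self-adjoint closure, that closure is $(a+b)(X,P)$. -/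

import Mathlib

open MeasureTheory
open scoped ContDiff SchwartzMap

noncomputable section

namespace QuantumIntegrability

/-! ### Projection-valued measures and spectral integrals -/

section Abstract

variable {ℋ : Type*} [NormedAddCommGroup ℋ] [InnerProductSpace ℂ ℋ] [CompleteSpace ℋ]

/-- A projection-valued measure on `α` with values in the orthogonal projections of `ℋ`
(only the values on measurable sets matter). -/
structure PVM (α : Type*) [MeasurableSpace α] (ℋ : Type*) [NormedAddCommGroup ℋ]
    [InnerProductSpace ℂ ℋ] [CompleteSpace ℋ] where
  proj : Set α → ℋ →L[ℂ] ℋ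
  isStarProjection : ∀ s, MeasurableSet s → IsStarProjection (proj s)
  proj_empty : proj ∅ = 0
  proj_univ : proj Set.univ = 1
  proj_inter : ∀ s t, MeasurableSet s → MeasurableSet t → proj (s ∩ t) = proj s * proj t
  hasSum_iUnion : ∀ s : ℕ → Set α, (∀ i, MeasurableSet (s i)) →
    Pairwise (Function.onFun Disjoint s) → ∀ ψ : ℋ,
      HasSum (fun i => proj (s i) ψ) (proj (⋃ i, s i) ψ)

variable {α : Type*} [MeasurableSpace α]

theorem PVM.inner_proj (E : PVM α ℋ) {s : Set α} (hs : MeasurableSet s) (ψ : ℋ) :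
    RCLike.re (inner ℂ ψ (E.proj s ψ)) = ‖E.proj s ψ‖ ^ 2 := by
  have h := E.isStarProjection s hs
  have h1 : E.proj s (E.proj s ψ) = E.proj s ψ := by
    have := congrArg (fun T : ℋ →L[ℂ] ℋ => T ψ) h.isIdempotentElem.eq
    simpa using this
  have h2 := (ContinuousLinearMap.isSelfAdjoint_iff_isSymmetric.mp h.isSelfAdjoint) ψ
    (E.proj s ψ)
  simp only [ContinuousLinearMap.coe_coe] at h2
  rw [h1] at h2
  rw [← h2, inner_self_eq_norm_sq]

/-- The spectral measure `μ_ψ(s) = ‖E(s) ψ‖²` of a vector `ψ`. -/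
def PVM.measure (E : PVM α ℋ) (ψ : ℋ) : Measure α :=
  Measure.ofMeasurable (fun s _ => ENNReal.ofReal (‖E.proj s ψ‖ ^ 2))
    (by simp [E.proj_empty])
    (by
      intro s hs hd
      have h := E.hasSum_iUnion s hs hd ψ
      have h' : HasSum (fun i => ‖E.proj (s i) ψ‖ ^ 2) (‖E.proj (⋃ i, s i) ψ‖ ^ 2) := by
        have h3 := (RCLike.reCLM (K := ℂ)).hasSum ((innerSL ℂ ψ).hasSum h)
        simp only [innerSL_apply_apply, RCLike.reCLM_apply,
          E.inner_proj (hs _), E.inner_proj (MeasurableSet.iUnion hs)] at h3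
        exact h3
      rw [← h'.tsum_eq, ENNReal.ofReal_tsum_of_nonneg (fun _ => by positivity) h'.summable])

theorem PVM.measure_apply (E : PVM α ℋ) (ψ : ℋ) {s : Set α} (hs : MeasurableSet s) :
    E.measure ψ s = ENNReal.ofReal (‖E.proj s ψ‖ ^ 2) :=
  Measure.ofMeasurable_apply s hs

/-- `B = ∫ f dE` for a real-valued measurable `f`: the domain of `B` consists of the `ψ` with
`f ∈ L²(μ_ψ)`, and `⟨ψ, B ψ⟩ = ∫ f dμ_ψ` on it (which determines `B` by polarization). -/
def PVM.IsIntegral (E : PVM α ℋ) (f : α → ℝ) (B : ℋ →ₗ.[ℂ] ℋ) : Prop :=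
  (∀ ψ : ℋ, ψ ∈ B.domain ↔ Integrable (fun x => f x ^ 2) (E.measure ψ)) ∧
    ∀ ψ : B.domain, inner ℂ (ψ : ℋ) (B ψ) = ((∫ x, f x ∂(E.measure (ψ : ℋ)) : ℝ) : ℂ)

/-- `E` is the spectral resolution of `T`, i.e. `T = ∫ x dE(x)`. -/
def IsSpectralResolution (E : PVM ℝ ℋ) (T : ℋ →ₗ.[ℂ] ℋ) : Prop :=
  E.IsIntegral (fun x => x) T

/-- `E` is the joint spectral resolution of the family `T`, i.e. `T j = ∫ x_j dE(x)`. -/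
def IsJointSpectralResolution {ι : Type*} (E : PVM (ι → ℝ) ℋ) (T : ι → ℋ →ₗ.[ℂ] ℋ) : Prop :=
  ∀ j, E.IsIntegral (fun x => x j) (T j)

/-- Two (possibly unbounded) self-adjoint operators commute: all their spectral projections
commute. -/
def StronglyCommute (S T : ℋ →ₗ.[ℂ] ℋ) : Prop :=
  ∃ E F : PVM ℝ ℋ, IsSpectralResolution E S ∧ IsSpectralResolution F T ∧
    ∀ s t, MeasurableSet s → MeasurableSet t → Commute (E.proj s) (F.proj t)

/-- `B` is a (Borel) function of the commuting family `T`, in the sense of the joint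
functional calculus. -/
def IsFunctionOf {ι : Type*} (B : ℋ →ₗ.[ℂ] ℋ) (T : ι → ℋ →ₗ.[ℂ] ℋ) : Prop :=
  ∃ E : PVM (ι → ℝ) ℋ, IsJointSpectralResolution E T ∧
    ∃ f : (ι → ℝ) → ℝ, Measurable f ∧ E.IsIntegral f B

/-- Commuting operators are functionally independent: none is a function of the others. -/
def FunctionallyIndependent {ι : Type*} (T : ι → ℋ →ₗ.[ℂ] ℋ) : Prop :=
  ∀ i, ¬ IsFunctionOf (T i) (fun j : {j : ι // j ≠ i} => T j)

/-- `T` is a family of commuting, self-adjoint, functionally independent first integrals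
of `H`. -/
structure AreFirstIntegrals {ι : Type*} (H : ℋ →ₗ.[ℂ] ℋ) (T : ι → ℋ →ₗ.[ℂ] ℋ) : Prop where
  selfAdjoint : ∀ i, IsSelfAdjoint (T i)
  commute : ∀ i j, StronglyCommute (T i) (T j)
  commute_hamiltonian : ∀ i, StronglyCommute H (T i)
  independent : FunctionallyIndependent T

/-! ### Pure point spectrum -/

/-- The subspace `ℋ_cont` of the vectors whose spectral measure has no atoms. -/
def PVM.contSubspace (E : PVM ℝ ℋ) : Submodule ℂ ℋ where
  carrier := {ψ | ∀ x : ℝ, E.measure ψ {x} = 0}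
  zero_mem' := fun x => by simp [E.measure_apply]
  add_mem' := by
    intro a b ha hb x
    have ha := ha x
    have hb := hb x
    rw [E.measure_apply _ (measurableSet_singleton x), ENNReal.ofReal_eq_zero] at ha hb ⊢
    have ha' : E.proj {x} a = 0 := by
      rw [← norm_eq_zero]; exact pow_eq_zero_iff (two_ne_zero) |>.mp (le_antisymm ha (by positivity))
    have hb' : E.proj {x} b = 0 := by
      rw [← norm_eq_zero]; exact pow_eq_zero_iff (two_ne_zero) |>.mp (le_antisymm hb (by positivity))
    simp [ha', hb']
  smul_mem' := by
    intro c a ha x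
    have ha := ha x
    rw [E.measure_apply _ (measurableSet_singleton x), ENNReal.ofReal_eq_zero] at ha ⊢
    have ha' : E.proj {x} a = 0 := by
      rw [← norm_eq_zero]; exact pow_eq_zero_iff (two_ne_zero) |>.mp (le_antisymm ha (by positivity))
    simp [ha']

end Abstract

section Spectrum

variable {ℋ : Type*} [NormedAddCommGroup ℋ] [InnerProductSpace ℂ ℋ]

/-- The resolvent set of an operator: the `z` for which `T - z` is a bijection of the domain
of `T` onto `ℋ` with bounded inverse. -/
def resolventSet (T : ℋ →ₗ.[ℂ] ℋ) : Set ℂ :=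
  {z | ∃ R : ℋ →L[ℂ] ℋ,
    (∀ w : ℋ, ∃ h : R w ∈ T.domain, T ⟨R w, h⟩ - z • R w = w) ∧
      ∀ x : T.domain, R (T x - z • (x : ℋ)) = x}

/-- The spectrum of an operator. -/
def spectrum (T : ℋ →ₗ.[ℂ] ℋ) : Set ℂ :=
  (resolventSet T)ᶜ

/-- The restriction of an operator to a subspace `K`, as an operator in `K`. -/
def restrictTo (T : ℋ →ₗ.[ℂ] ℋ) (K : Submodule ℂ ℋ) : K →ₗ.[ℂ] K where
  domain :=
    { carrier := {x | ∃ h : (x : ℋ) ∈ T.domain, T ⟨x, h⟩ ∈ K}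
      zero_mem' := ⟨T.domain.zero_mem, by
        have h : T ⟨((0 : K) : ℋ), T.domain.zero_mem⟩ = 0 := T.map_zero
        rw [h]; exact K.zero_mem⟩
      add_mem' := by
        rintro a b ⟨ha, ha'⟩ ⟨hb, hb'⟩
        refine ⟨T.domain.add_mem ha hb, ?_⟩
        have h : T ⟨((a + b : K) : ℋ), T.domain.add_mem ha hb⟩ = T ⟨a, ha⟩ + T ⟨b, hb⟩ :=
          T.map_add ⟨a, ha⟩ ⟨b, hb⟩
        rw [h]; exact K.add_mem ha' hb'
      smul_mem' := by
        rintro c a ⟨ha, ha'⟩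
        refine ⟨T.domain.smul_mem c ha, ?_⟩
        have h : T ⟨((c • a : K) : ℋ), T.domain.smul_mem c ha⟩ = c • T ⟨a, ha⟩ :=
          T.map_smul c ⟨a, ha⟩
        rw [h]; exact K.smul_mem c ha' }
  toFun :=
    { toFun := fun x => ⟨T ⟨((x : K) : ℋ), x.2.1⟩, x.2.2⟩
      map_add' := fun a b => Subtype.ext
        (T.map_add ⟨((a : K) : ℋ), a.2.1⟩ ⟨((b : K) : ℋ), b.2.1⟩)
      map_smul' := fun c a => Subtype.ext (T.map_smul c ⟨((a : K) : ℋ), a.2.1⟩) }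

/-- A self-adjoint operator has pure point spectrum: its continuous spectrum, i.e. the spectrum
of its restriction to `ℋ_cont`, is empty. -/
def HasPurePointSpectrum [CompleteSpace ℋ] (H : ℋ →ₗ.[ℂ] ℋ) : Prop :=
  ∃ E : PVM ℝ ℋ, IsSpectralResolution E H ∧ spectrum (restrictTo H E.contSubspace) = ∅

end Spectrum

/-! ### Functions of the position and momentum operators -/

/-- The Hilbert space `L²(ℝⁿ)`. -/
abbrev L2 (n : ℕ) : Type :=
  Lp ℂ 2 (volume : Measure (EuclideanSpace ℝ (Fin n)))

/-- Classical phase space `ℝ²ⁿ`; `Sum.inl j` is the coordinate `x_j`, `Sum.inr j` is `p_j`. -/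
abbrev Phase (n : ℕ) : Type := Fin n ⊕ Fin n → ℝ

/-- The position operator `X_j` on Schwartz functions. -/
def position {n : ℕ} (j : Fin n) : Module.End ℂ 𝓢(EuclideanSpace ℝ (Fin n), ℂ) :=
  (SchwartzMap.smulLeftCLM ℂ (fun x : EuclideanSpace ℝ (Fin n) => ((x j : ℝ) : ℂ))).toLinearMap

/-- The momentum operator `P_j = -i ∂_j` on Schwartz functions. -/
def momentum {n : ℕ} (j : Fin n) : Module.End ℂ 𝓢(EuclideanSpace ℝ (Fin n), ℂ) :=
  (-Complex.I) • (LineDeriv.lineDerivOpCLM ℂ 𝓢(EuclideanSpace ℝ (Fin n), ℂ)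
    (EuclideanSpace.single j (1 : ℝ))).toLinearMap

theorem position_apply {n : ℕ} (j : Fin n) (φ : 𝓢(EuclideanSpace ℝ (Fin n), ℂ))
    (x : EuclideanSpace ℝ (Fin n)) : position j φ x = (x j : ℂ) * φ x := by
  have h : (fun x : EuclideanSpace ℝ (Fin n) => ((x j : ℝ) : ℂ)).HasTemperateGrowth := by
    have h1 : (fun x : EuclideanSpace ℝ (Fin n) => x j).HasTemperateGrowth :=
      (EuclideanSpace.proj (𝕜 := ℝ) j).hasTemperateGrowth
    fun_prop
  simp [position, SchwartzMap.smulLeftCLM_apply_apply h]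

theorem momentum_apply {n : ℕ} (j : Fin n) (φ : 𝓢(EuclideanSpace ℝ (Fin n), ℂ))
    (x : EuclideanSpace ℝ (Fin n)) :
    momentum j φ x = -Complex.I * fderiv ℝ φ x (EuclideanSpace.single j 1) := by
  simp [momentum, SchwartzMap.lineDerivOp_apply_eq_fderiv]

/-- The Weyl (totally symmetrized) quantization of a monomial: the average, over all orderings
of its factors, of the corresponding products of position and momentum operators. -/
def weylMonomial {n : ℕ} (s : (Fin n ⊕ Fin n) →₀ ℕ) :
    Module.End ℂ 𝓢(EuclideanSpace ℝ (Fin n), ℂ) :=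
  let l := (Finsupp.toMultiset s).toList
  ((l.length.factorial : ℂ))⁻¹ •
    (l.permutations.map fun l' => (l'.map (Sum.elim position momentum)).prod).sum

/-- The Weyl quantization of a real polynomial on phase space, acting on Schwartz functions. -/
def weyl {n : ℕ} (q : MvPolynomial (Fin n ⊕ Fin n) ℝ) :
    Module.End ℂ 𝓢(EuclideanSpace ℝ (Fin n), ℂ) :=
  ∑ s ∈ q.support, ((q.coeff s : ℝ) : ℂ) • weylMonomial s

/-- `A` is the closure of the operator `D` on Schwartz functions. -/
def IsClosureOf {n : ℕ} (A : L2 n →ₗ.[ℂ] L2 n)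
    (D : Module.End ℂ 𝓢(EuclideanSpace ℝ (Fin n), ℂ)) : Prop :=
  (A.graph : Set (L2 n × L2 n)) =
    closure (Set.range fun φ : 𝓢(EuclideanSpace ℝ (Fin n), ℂ) => (φ.toLp 2, (D φ).toLp 2))

/-- `IsQuantization a A`: the self-adjoint operator `A` on `L²(ℝⁿ)` is the smooth function
`a(X, P)` of the position and momentum operators. The class is generated from the polynomials in
`X` and `P` by smooth functions of commuting operators and by sums. -/
inductive IsQuantization {n : ℕ} : (Phase n → ℝ) → (L2 n →ₗ.[ℂ] L2 n) → Prop
  | polynomial (q : MvPolynomial (Fin n ⊕ Fin n) ℝ) (A : L2 n →ₗ.[ℂ] L2 n)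
      (hA : IsSelfAdjoint A) (hq : IsClosureOf A (weyl q)) :
      IsQuantization (fun z => MvPolynomial.eval z q) A
  | calculus {k : ℕ} (t : Fin k → Phase n → ℝ) (T : Fin k → L2 n →ₗ.[ℂ] L2 n)
      (hT : ∀ j, IsQuantization (t j) (T j))
      (E : PVM (Fin k → ℝ) (L2 n)) (hE : IsJointSpectralResolution E T)
      (f : (Fin k → ℝ) → ℝ) (hf : ContDiff ℝ ∞ f)
      (A : L2 n →ₗ.[ℂ] L2 n) (hA : E.IsIntegral f A) :
      IsQuantization (fun z => f (fun j => t j z)) A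
  | sum (a b : Phase n → ℝ) (A B C : L2 n →ₗ.[ℂ] L2 n)
      (ha : IsQuantization a A) (hb : IsQuantization b B) (hC : IsSelfAdjoint C)
      (hsum : C.graph = (A + B).graph.topologicalClosure) :
      IsQuantization (fun z => a z + b z) C

/-- The Poisson bracket on phase space. -/
def poisson {n : ℕ} (a b : Phase n → ℝ) (z : Phase n) : ℝ :=
  ∑ j : Fin n,
    (fderiv ℝ a z (Pi.single (Sum.inl j) 1) * fderiv ℝ b z (Pi.single (Sum.inr j) 1) -
      fderiv ℝ a z (Pi.single (Sum.inr j) 1) * fderiv ℝ b z (Pi.single (Sum.inl j) 1))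

/-- Liouville integrability of the classical Hamiltonian `a`: the `t i` are smooth first integrals
in involution, with differentials linearly independent on a dense set. -/
structure IsLiouvilleIntegrable {n : ℕ} (a : Phase n → ℝ) (t : Fin n → Phase n → ℝ) : Prop where
  smooth_hamiltonian : ContDiff ℝ ∞ a
  smooth : ∀ i, ContDiff ℝ ∞ (t i)
  first_integral : ∀ i z, poisson a (t i) z = 0
  involution : ∀ i j z, poisson (t i) (t j) z = 0
  independent : Dense {z | LinearIndependent ℝ (fun i => fderiv ℝ (t i) z)}

/-! ### Integrability -/

section Integrability

variable {ℋ : Type*} [NormedAddCommGroup ℋ] [InnerProductSpace ℂ ℋ] [CompleteSpace ℋ]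

/-- `U H U⁻¹ = A`, domains included. -/
def Intertwines {n : ℕ} (U : ℋ ≃ₗᵢ[ℂ] L2 n) (H : ℋ →ₗ.[ℂ] ℋ) (A : L2 n →ₗ.[ℂ] L2 n) : Prop :=
  ∀ ψ φ : ℋ, (ψ, φ) ∈ H.graph ↔ (U ψ, U φ) ∈ A.graph

/-- The Hamiltonian `H` is integrable, as an `n`-dimensional Hamiltonian, with the self-adjoint
commuting first integrals `T i`: a unitary map onto `L²(ℝⁿ)` turns `H` and the `T i` into
operators `A` and `N i` that are smooth functions `a(X, P)`, `t i (X, P)` of position and momentum,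
where the `t i` make `a` a classically integrable Hamiltonian. -/
def IsIntegrableWith (n : ℕ) (H : ℋ →ₗ.[ℂ] ℋ) (T : Fin n → ℋ →ₗ.[ℂ] ℋ) : Prop :=
  AreFirstIntegrals H T ∧
    ∃ (U : ℋ ≃ₗᵢ[ℂ] L2 n) (A : L2 n →ₗ.[ℂ] L2 n) (N : Fin n → L2 n →ₗ.[ℂ] L2 n)
      (a : Phase n → ℝ) (t : Fin n → Phase n → ℝ),
      IsSelfAdjoint A ∧ Intertwines U H A ∧ (∀ i, Intertwines U (T i) (N i)) ∧
      AreFirstIntegrals A N ∧ IsQuantization a A ∧ (∀ i, IsQuantization (t i) (N i)) ∧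
      IsLiouvilleIntegrable a t

end Integrability

end QuantumIntegrability

end

/-! A countable spectrum forces a Hilbert basis of eigenvectors. A countable set misses some real
`x`, and the resolvent of `H` at `x` is a bounded self-adjoint operator whose spectrum is again
countable. A nonempty closed countable set of reals has an isolated point; its indicator function,
through the continuous functional calculus, yields an eigenvector, and Zorn's lemma turns this into
an eigenbasis (`exists_eigenbasis`). So `H` is diagonal, and pure point spectrum follows
(`hasPurePointSpectrum_diagOp`).

For integrability, a diagonal operator is determined up to a unitary map by its list of eigenvalues.
Since `ℋ` is separable and infinite-dimensional and `n ≥ 1`, the eigenbasis can be indexed by `ℕⁿ`,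
by any bijection whatever, and sent to the Hermite basis of `L²(ℝⁿ)`. There the number operators
`N_j` of `n` harmonic oscillators have eigenvalue `m_j` at the index `m`, while `H` has some
arbitrary eigenvalue `l m`. As `ℕⁿ` is discrete in `ℝⁿ`, a smooth `f` with `f(m) = l m` exists
(`exists_contDiff_interpolation`), so `H` becomes `f(N_1, …, N_n)`, with symbol `f` of the
oscillator functions `(x_j² + p_j² - 1)/2`, which are in involution.

The remaining work is the completeness of the Hermite functions (`hermiteBasis`), the fact that
Schwartz functions are a core for the number operators (`isClosureOf_number`), and functional
independence (`functionallyIndependent_diagOp`). -/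

noncomputable section

namespace QuantumIntegrability

/-! ### Operators diagonal in a Hilbert basis -/

section Diagonal

variable {ℋ : Type*} [NormedAddCommGroup ℋ] [InnerProductSpace ℂ ℋ]
variable {ι : Type*} (b : HilbertBasis ι ℂ ℋ)

theorem hasSum_norm_sq_repr (ψ : ℋ) :
    HasSum (fun i => ‖b.repr ψ i‖ ^ 2) (‖ψ‖ ^ 2) := by
  have h := (RCLike.reCLM (K := ℂ)).hasSum (b.hasSum_inner_mul_inner ψ ψ)
  simp only [RCLike.reCLM_apply] at h
  rw [inner_self_eq_norm_sq] at h
  convert! h using 2 with i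
  rw [b.repr_apply_apply, ← inner_conj_symm ψ (b i), RCLike.conj_mul]
  norm_cast

theorem repr_basis_of_ne {i j : ι} (h : i ≠ j) : b.repr (b i) j = 0 := by
  rw [b.repr_apply_apply]
  exact b.orthonormal.inner_eq_zero h.symm

theorem eq_of_repr_eq {ψ φ : ℋ} (h : ∀ i, b.repr ψ i = b.repr φ i) : ψ = φ :=
  b.repr.injective (lp.ext (funext h))

theorem memℓp_two_iff {f : ι → ℂ} : Memℓp f 2 ↔ Summable fun i => ‖f i‖ ^ 2 := by
  rw [memℓp_gen_iff (by simp)]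
  simp

/-- The vectors `ψ` for which `l i * ψ i` is square summable. -/
def diagDomain (l : ι → ℝ) : Submodule ℂ ℋ where
  carrier := {ψ | Memℓp (fun i => (l i : ℂ) * b.repr ψ i) 2}
  zero_mem' := by
    change Memℓp (fun i => (l i : ℂ) * b.repr 0 i) 2
    rw [memℓp_two_iff]
    simp [summable_zero]
  add_mem' := by
    intro ψ φ hψ hφ
    have h : (fun i => (l i : ℂ) * b.repr (ψ + φ) i) =
        (fun i => (l i : ℂ) * b.repr ψ i) + fun i => (l i : ℂ) * b.repr φ i := by
      ext i
      simp [mul_add]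
    change Memℓp (fun i => (l i : ℂ) * b.repr (ψ + φ) i) 2
    rw [h]
    exact Memℓp.add hψ hφ
  smul_mem' := by
    intro c ψ hψ
    have h : (fun i => (l i : ℂ) * b.repr (c • ψ) i) =
        c • fun i => (l i : ℂ) * b.repr ψ i := by
      ext i
      simp [mul_left_comm]
    change Memℓp (fun i => (l i : ℂ) * b.repr (c • ψ) i) 2
    rw [h]
    exact Memℓp.const_smul hψ c

/-- The operator that multiplies the `i`-th coordinate by `l i`, on its maximal domain. -/
def diagOp (l : ι → ℝ) : ℋ →ₗ.[ℂ] ℋ where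
  domain := diagDomain b l
  toFun :=
    { toFun := fun ψ => b.repr.symm ⟨fun i => (l i : ℂ) * b.repr (ψ : ℋ) i, ψ.2⟩
      map_add' := by
        intro ψ φ
        refine eq_of_repr_eq b fun i => ?_
        rw [map_add, lp.coeFn_add, Pi.add_apply]
        simp only [LinearIsometryEquiv.apply_symm_apply]
        rw [Submodule.coe_add, map_add, lp.coeFn_add, Pi.add_apply, mul_add]
      map_smul' := by
        intro c ψ
        refine eq_of_repr_eq b fun i => ?_
        rw [RingHom.id_apply, map_smul, lp.coeFn_smul, Pi.smul_apply, smul_eq_mul]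
        simp only [LinearIsometryEquiv.apply_symm_apply]
        rw [Submodule.coe_smul, map_smul, lp.coeFn_smul, Pi.smul_apply, smul_eq_mul,
          mul_left_comm] }

theorem mem_diagOp_domain (l : ι → ℝ) (ψ : ℋ) :
    ψ ∈ (diagOp b l).domain ↔ Summable fun i => l i ^ 2 * ‖b.repr ψ i‖ ^ 2 := by
  change Memℓp (fun i => (l i : ℂ) * b.repr ψ i) 2 ↔ _
  rw [memℓp_two_iff]
  simp [mul_pow]

theorem repr_diagOp (l : ι → ℝ) (ψ : (diagOp b l).domain) (i : ι) :
    b.repr (diagOp b l ψ) i = l i * b.repr (ψ : ℋ) i := by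
  change b.repr (b.repr.symm _) i = _
  rw [LinearIsometryEquiv.apply_symm_apply]

/-- No domain condition is needed: the coordinates of `p.2` are square summable anyway, and this is
exactly membership of `p.1` in the domain. -/
theorem mem_graph_diagOp (l : ι → ℝ) (p : ℋ × ℋ) :
    p ∈ (diagOp b l).graph ↔ ∀ i, b.repr p.2 i = l i * b.repr p.1 i := by
  rw [LinearPMap.mem_graph_iff]
  constructor
  · rintro ⟨ψ, h1, h2⟩ i
    rw [← h1, ← h2, repr_diagOp]
  · intro h
    have hd : p.1 ∈ (diagOp b l).domain := by
      change Memℓp (fun i => (l i : ℂ) * b.repr p.1 i) 2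
      rw [← funext h]
      exact lp.memℓp (b.repr p.2)
    refine ⟨⟨p.1, hd⟩, rfl, eq_of_repr_eq b fun i => ?_⟩
    rw [repr_diagOp, h]

theorem basis_mem_graph_diagOp (l : ι → ℝ) (i : ι) :
    (b i, (l i : ℂ) • b i) ∈ (diagOp b l).graph := by
  rw [mem_graph_diagOp]
  intro j
  dsimp only
  rw [map_smul, lp.coeFn_smul, Pi.smul_apply, smul_eq_mul]
  by_cases h : i = j
  · rw [h]
  · rw [repr_basis_of_ne b h, mul_zero, mul_zero]

theorem dense_diagOp_domain (l : ι → ℝ) : Dense ((diagOp b l).domain : Set ℋ) := by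
  have h1 : Submodule.span ℂ (Set.range b) ≤ (diagOp b l).domain := by
    rw [Submodule.span_le]
    rintro _ ⟨i, rfl⟩
    exact LinearPMap.mem_domain_of_mem_graph (basis_mem_graph_diagOp b l i)
  have h2 : Dense (Submodule.span ℂ (Set.range b) : Set ℋ) := by
    rw [Submodule.dense_iff_topologicalClosure_eq_top]
    exact b.dense_span
  exact h2.mono h1

theorem intertwines_diagOp {n : ℕ} (c : HilbertBasis ι ℂ (L2 n)) (l : ι → ℝ) :
    Intertwines (b.repr.trans c.repr.symm) (diagOp b l) (diagOp c l) := by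
  intro ψ φ
  rw [mem_graph_diagOp, mem_graph_diagOp]
  simp

theorem isFormalAdjoint_diagOp (l : ι → ℝ) : (diagOp b l).IsFormalAdjoint (diagOp b l) := by
  intro ψ φ
  rw [← b.repr.inner_map_map, ← b.repr.inner_map_map, lp.inner_eq_tsum, lp.inner_eq_tsum]
  congr 1
  ext i
  rw [repr_diagOp, repr_diagOp]
  simp
  ring

/-- Pairing `S ψ` with the eigenvector `b i` of `T` moves `S` across and gives the coordinate `l i *
ψ i`. This expresses the maximality of the domain of `diagOp`. -/
theorem le_diagOp {S T : ℋ →ₗ.[ℂ] ℋ} (hST : S.IsFormalAdjoint T) {l : ι → ℝ}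
    (h : ∀ i, (b i, (l i : ℂ) • b i) ∈ T.graph) : S ≤ diagOp b l := by
  refine LinearPMap.le_of_le_graph ?_
  rintro p hp
  obtain ⟨ψ, h1, h2⟩ := (LinearPMap.mem_graph_iff _).mp hp
  rw [mem_graph_diagOp]
  intro i
  obtain ⟨e, he1, he2⟩ := (LinearPMap.mem_graph_iff _).mp (h i)
  have := hST ψ e
  dsimp only at he1 he2
  rw [he1, he2, h1, h2] at this
  rw [b.repr_apply_apply, b.repr_apply_apply, ← inner_conj_symm, this, inner_smul_right]
  simp

/-- The vectors whose coordinates vanish outside `t`. -/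
def coordSubspace (t : Set ι) : Submodule ℂ ℋ := (Submodule.span ℂ (b '' tᶜ))ᗮ

theorem mem_coordSubspace {t : Set ι} {ψ : ℋ} :
    ψ ∈ coordSubspace b t ↔ ∀ i ∉ t, b.repr ψ i = 0 := by
  simp only [b.repr_apply_apply]
  constructor
  · intro h i hi
    exact (Submodule.mem_orthogonal _ _).mp h _ (Submodule.subset_span ⟨i, hi, rfl⟩)
  · intro h
    rw [coordSubspace, Submodule.mem_orthogonal]
    intro u hu
    induction hu using Submodule.span_induction with
    | mem x hx => obtain ⟨i, hi, rfl⟩ := hx; exact h i hi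
    | zero => simp
    | add x y _ _ hx hy => rw [inner_add_left, hx, hy, add_zero]
    | smul c x _ hx => rw [inner_smul_left, hx, mul_zero]

variable [CompleteSpace ℋ]

/-- Symmetry puts the operator inside its adjoint; `le_diagOp`, with the adjoint as `S`, gives the
converse. -/
theorem isSelfAdjoint_diagOp (l : ι → ℝ) : IsSelfAdjoint (diagOp b l) := by
  rw [LinearPMap.isSelfAdjoint_def]
  have hd := dense_diagOp_domain b l
  exact le_antisymm
    (le_diagOp b (LinearPMap.adjoint_isFormalAdjoint hd) (basis_mem_graph_diagOp b l))
    ((isFormalAdjoint_diagOp b l).le_adjoint hd)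

/-- A self-adjoint operator with a Hilbert basis of eigenvectors is diagonal in it. -/
theorem eq_diagOp_of_eigenbasis {H : ℋ →ₗ.[ℂ] ℋ} (hH : IsSelfAdjoint H) {l : ι → ℝ}
    (h : ∀ i, (b i, (l i : ℂ) • b i) ∈ H.graph) : H = diagOp b l := by
  have hHH : H.IsFormalAdjoint H := by
    have := LinearPMap.adjoint_isFormalAdjoint hH.dense_domain
    rwa [LinearPMap.isSelfAdjoint_def.mp hH] at this
  have hle := le_diagOp b hHH h
  refine le_antisymm hle ?_
  -- Self-adjoint operators have no proper symmetric extensions: `diagOp b l` extends `H`, hence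
  -- lies in the adjoint of `H`, which is `H`.
  have : (diagOp b l) ≤ H.adjoint := by
    refine LinearPMap.IsFormalAdjoint.le_adjoint hH.dense_domain ?_
    intro ψ φ
    have e : H ψ = diagOp b l ⟨ψ, hle.1 ψ.2⟩ := hle.2 rfl
    rw [e]
    exact isFormalAdjoint_diagOp b l _ φ
  rwa [LinearPMap.isSelfAdjoint_def.mp hH] at this

/-! ### The projection-valued measure of a diagonal family -/

variable {α : Type*}

instance (t : Set ι) : (coordSubspace b t).HasOrthogonalProjection :=
  inferInstanceAs ((Submodule.span ℂ (b '' tᶜ))ᗮ).HasOrthogonalProjection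

theorem repr_starProjection_coordSubspace (t : Set ι) (ψ : ℋ) (i : ι) :
    b.repr ((coordSubspace b t).starProjection ψ) i = t.indicator (fun i => b.repr ψ i) i := by
  by_cases hi : i ∈ t
  · have hb : b i ∈ coordSubspace b t := by
      rw [mem_coordSubspace]
      intro j hj
      exact repr_basis_of_ne b (fun h => hj (h ▸ hi))
    rw [Set.indicator_of_mem hi, b.repr_apply_apply, b.repr_apply_apply,
      ← Submodule.inner_starProjection_left_eq_right, Submodule.starProjection_eq_self_iff.mpr hb]
  · rw [Set.indicator_of_notMem hi]
    exact (mem_coordSubspace b).mp (Submodule.starProjection_apply_mem _ ψ) i hi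

theorem hasSum_starProjection_coordSubspace (t : Set ι) (ψ : ℋ) :
    HasSum (fun i : t => b.repr ψ i • b i) ((coordSubspace b t).starProjection ψ) := by
  have h := b.hasSum_repr ((coordSubspace b t).starProjection ψ)
  simp only [repr_starProjection_coordSubspace] at h
  refine (hasSum_subtype_iff_indicator (f := fun i => b.repr ψ i • b i)).mpr ?_
  convert! h using 2 with i
  by_cases hi : i ∈ t <;> simp [hi]

variable [MeasurableSpace α]

/-- The projection-valued measure whose value on `s` projects onto the coordinates `i` with
`g i ∈ s`. -/
def diagPVM (g : ι → α) : PVM α ℋ where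
  proj s := (coordSubspace b (g ⁻¹' s)).starProjection
  isStarProjection s _ := isStarProjection_starProjection
  proj_empty := by
    ext ψ
    refine eq_of_repr_eq b fun i => ?_
    simp [repr_starProjection_coordSubspace]
  proj_univ := by
    ext ψ
    refine eq_of_repr_eq b fun i => ?_
    simp [repr_starProjection_coordSubspace]
  proj_inter s t _ _ := by
    ext ψ
    refine eq_of_repr_eq b fun i => ?_
    by_cases hs : g i ∈ s <;> by_cases ht : g i ∈ t <;>
      simp [repr_starProjection_coordSubspace, Set.indicator, hs, ht]
  hasSum_iUnion s _ hd ψ := by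
    have hd' : Pairwise (Function.onFun Disjoint fun n => g ⁻¹' s n) :=
      fun m n hmn => (hd hmn).preimage g
    have h := hasSum_starProjection_coordSubspace b (g ⁻¹' ⋃ n, s n) ψ
    rw [Set.preimage_iUnion] at h ⊢
    rw [← (Set.unionEqSigmaOfDisjoint hd').symm.hasSum_iff] at h
    exact h.sigma fun n => hasSum_starProjection_coordSubspace b (g ⁻¹' s n) ψ

theorem repr_diagPVM_proj (g : ι → α) (s : Set α) (ψ : ℋ) (i : ι) :
    b.repr ((diagPVM b g).proj s ψ) i = (g ⁻¹' s).indicator (fun i => b.repr ψ i) i :=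
  repr_starProjection_coordSubspace b _ ψ i

/-- Parseval for the projected vector. Spectral measures are sums of Dirac masses, so spectral
integrals become series. -/
theorem measure_diagPVM (g : ι → α) (ψ : ℋ) :
    (diagPVM b g).measure ψ =
      Measure.sum fun i => ENNReal.ofReal (‖b.repr ψ i‖ ^ 2) • Measure.dirac (g i) := by
  ext s hs
  rw [PVM.measure_apply _ _ hs, Measure.sum_apply _ hs,
    ← (hasSum_norm_sq_repr b _).tsum_eq, ENNReal.ofReal_tsum_of_nonneg (fun _ => by positivity)
      (hasSum_norm_sq_repr b _).summable]
  congr 1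
  ext i
  rw [repr_diagPVM_proj]
  by_cases hi : g i ∈ s <;> simp [hi, hs]

theorem isIntegral_diagPVM [Countable ι] [MeasurableSingletonClass α] (g : ι → α) (f : α → ℝ) :
    (diagPVM b g).IsIntegral f (diagOp b fun i => f (g i)) := by
  constructor
  · intro ψ
    rw [measure_diagPVM, integrable_sum_dirac_iff (fun i => ENNReal.ofReal_ne_top),
      mem_diagOp_domain]
    simp [mul_comm]
  · intro ψ
    rw [measure_diagPVM, integral_sum_dirac (fun i => ENNReal.ofReal_ne_top),
      ← b.repr.inner_map_map, lp.inner_eq_tsum, Complex.ofReal_tsum]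
    congr 1
    ext i
    rw [repr_diagOp, RCLike.inner_apply, mul_assoc, RCLike.mul_conj,
      ENNReal.toReal_ofReal (by positivity), smul_eq_mul, mul_comm]
    push_cast
    rfl

theorem commute_diagPVM {β : Type*} [MeasurableSpace β] (g : ι → α) (k : ι → β) (s : Set α)
    (t : Set β) : Commute ((diagPVM b g).proj s) ((diagPVM b k).proj t) := by
  ext ψ
  refine eq_of_repr_eq b fun i => ?_
  by_cases hs : g i ∈ s <;> by_cases ht : k i ∈ t <;>
    simp [repr_diagPVM_proj, Set.indicator, hs, ht]

theorem stronglyCommute_diagOp [Countable ι] (l m : ι → ℝ) :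
    StronglyCommute (diagOp b l) (diagOp b m) :=
  ⟨diagPVM b l, diagPVM b m, isIntegral_diagPVM b l fun x => x, isIntegral_diagPVM b m fun x => x,
    fun s t _ _ => commute_diagPVM b l m s t⟩

theorem spectrum_eq_empty_of_subsingleton {K : Type*} [NormedAddCommGroup K]
    [InnerProductSpace ℂ K] [Subsingleton K] (T : K →ₗ.[ℂ] K) : spectrum T = ∅ := by
  rw [spectrum, Set.compl_empty_iff, Set.eq_univ_iff_forall]
  intro z
  exact ⟨0, fun w => ⟨T.domain.zero_mem, Subsingleton.elim _ _⟩, fun x => Subsingleton.elim _ _⟩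

/-- The atom of `μ_ψ` at `l i` has mass at least `|ψ i|²`, so `ℋ_cont` is zero, and on the zero
space every number is in the resolvent set. -/
theorem hasPurePointSpectrum_diagOp [Countable ι] (l : ι → ℝ) :
    HasPurePointSpectrum (diagOp b l) := by
  refine ⟨diagPVM b l, isIntegral_diagPVM b l fun x => x, ?_⟩
  have : Subsingleton (diagPVM b l).contSubspace := by
    refine Submodule.subsingleton_iff_eq_bot.mpr ((Submodule.eq_bot_iff _).mpr fun ψ hψ => ?_)
    refine eq_of_repr_eq b fun i => ?_
    have h : (diagPVM b l).measure ψ {l i} = 0 := hψ (l i)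
    rw [measure_diagPVM, Measure.sum_apply _ (measurableSet_singleton _),
      ENNReal.tsum_eq_zero] at h
    simpa using h i
  exact spectrum_eq_empty_of_subsingleton _

end Diagonal

/-! ### Self-adjoint operators with countable spectrum -/

section CountableSpectrum

/-- Without isolated points `C` would be perfect and contain a copy of the uncountable Cantor space.
-/
theorem exists_isolated_of_countable {C : Set ℝ} (hC : IsClosed C) (hne : C.Nonempty)
    (hcount : C.Countable) : ∃ x ∈ C, ∃ U ∈ nhds x, ∀ y ∈ U ∩ C, y = x := by
  by_contra h
  push Not at h
  have hp : Perfect C := ⟨hC, preperfect_iff_nhds.mpr fun x hx U hU => h x hx U hU⟩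
  obtain ⟨f, hf, -, hinj⟩ := hp.exists_nat_bool_injection hne
  have h1 : (Set.range f).Countable := hcount.mono hf
  have h2 : Countable (ℕ → Bool) := by
    have := h1.to_subtype
    exact (Equiv.ofInjective f hinj).countable_iff.mpr this
  have h3 := Cardinal.mk_le_aleph0_iff.mpr h2
  rw [← Cardinal.power_def, Cardinal.mk_nat, Cardinal.mk_bool] at h3
  exact (Cardinal.cantor Cardinal.aleph0).not_ge h3

variable {K : Type*} [NormedAddCommGroup K] [InnerProductSpace ℂ K]

/-- The spectral mapping theorem for the resolvent of `H`. -/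
theorem spectrum_resolvent_subset {H : K →ₗ.[ℂ] K} {z₀ : ℂ} {R : K →L[ℂ] K}
    (hR1 : ∀ w : K, ∃ h : R w ∈ H.domain, H ⟨R w, h⟩ - z₀ • R w = w)
    (hR2 : ∀ x : H.domain, R (H x - z₀ • (x : K)) = x) :
    _root_.spectrum ℂ R ⊆ {m | m ≠ 0 → z₀ + m⁻¹ ∈ spectrum H} := by
  intro m hm hm0
  by_contra hres
  obtain ⟨S, hS1, hS2⟩ := not_not.mp hres
  apply hm
  -- The first resolvent identity for the points `z₀` and `z₀ + m⁻¹`; `hSR` is the same with the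
  -- factors exchanged.
  have hRS : ∀ w, R w - S w = -(m⁻¹ • R (S w)) := by
    intro w
    obtain ⟨h, hw⟩ := hS1 w
    have h2 := hR2 ⟨S w, h⟩
    have h3 : H ⟨S w, h⟩ - z₀ • S w = w + m⁻¹ • S w := by
      rw [sub_eq_iff_eq_add] at hw
      rw [hw]
      module
    dsimp only at h2
    rw [h3, map_add, map_smul] at h2
    linear_combination (norm := module) h2
  have hSR : ∀ w, R w - S w = -(m⁻¹ • S (R w)) := by
    intro w
    obtain ⟨h, hw⟩ := hR1 w
    have h2 := hS2 ⟨R w, h⟩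
    have h3 : H ⟨R w, h⟩ - (z₀ + m⁻¹) • R w = w - m⁻¹ • R w := by
      rw [sub_eq_iff_eq_add] at hw
      rw [hw]
      module
    dsimp only at h2
    rw [h3, map_sub, map_smul] at h2
    linear_combination (norm := module) -h2
  have hk : m⁻¹ * m = 1 := inv_mul_cancel₀ hm0
  -- Formally `m - R = m (H - z₀ - m⁻¹) R`, with inverse `m⁻¹ (H - z₀) S = m⁻¹ (1 + m⁻¹ S)`.
  refine ⟨⟨algebraMap ℂ _ m - R, m⁻¹ • 1 + (m⁻¹ * m⁻¹) • S, ?_, ?_⟩, rfl⟩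
  · ext w
    rw [Algebra.algebraMap_eq_smul_one]
    change m • (m⁻¹ • w + (m⁻¹ * m⁻¹) • S w) - R (m⁻¹ • w + (m⁻¹ * m⁻¹) • S w) = w
    rw [map_add, map_smul, map_smul]
    linear_combination (norm := module) (-m⁻¹) • hRS w + hk • w + (m⁻¹ * hk) • S w
  · ext w
    rw [Algebra.algebraMap_eq_smul_one]
    change m⁻¹ • (m • w - R w) + (m⁻¹ * m⁻¹) • S (m • w - R w) = w
    rw [map_sub, map_smul]
    linear_combination (norm := module) (-m⁻¹) • hSR w + hk • w + (m⁻¹ * hk) • S w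

variable [CompleteSpace K]

/-- At an isolated point `x` of the spectrum, the indicator of `{x}` is continuous on the spectrum.
Its functional calculus is a nonzero operator, and its range consists of eigenvectors because `y
f(y) = x f(y)`. -/
theorem exists_eigenvector_of_countable_spectrum [Nontrivial K] {A : K →L[ℂ] K}
    (hA : IsSelfAdjoint A) (hc : (_root_.spectrum ℝ A).Countable) :
    ∃ (r : ℝ) (v : K), v ≠ 0 ∧ A v = (r : ℂ) • v := by
  obtain ⟨x, hx, U, hU, hUx⟩ := exists_isolated_of_countable (spectrum.isClosed (𝕜 := ℝ) A)
    (ContinuousFunctionalCalculus.spectrum_nonempty A hA) hc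
  classical
  let f : ℝ → ℝ := fun y => if y = x then 1 else 0
  have hf : ContinuousOn f (_root_.spectrum ℝ A) := by
    intro y hy
    by_cases hyx : y = x
    · subst hyx
      have : ∀ᶠ z in nhdsWithin y (_root_.spectrum ℝ A), f z = f y := by
        filter_upwards [mem_nhdsWithin_of_mem_nhds hU, self_mem_nhdsWithin] with z hz1 hz2
        rw [hUx z ⟨hz1, hz2⟩]
      exact (continuousWithinAt_const (b := f y)).congr_of_eventuallyEq this rfl
    · have : ∀ᶠ z in nhdsWithin y (_root_.spectrum ℝ A), f z = f y := by
        filter_upwards [mem_nhdsWithin_of_mem_nhds (isOpen_ne.mem_nhds hyx)] with z hz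
        have hz' : z ≠ x := hz
        simp [f, hz', hyx]
      exact (continuousWithinAt_const (b := f y)).congr_of_eventuallyEq this rfl
  have hne : cfc f A ≠ 0 := by
    intro h0
    have h1 : (1 : ℝ) ∈ _root_.spectrum ℝ (cfc f A) := by
      rw [cfc_map_spectrum (R := ℝ) f A hA hf]
      exact ⟨x, hx, by simp [f]⟩
    rw [h0, spectrum.zero_eq] at h1
    simp at h1
  have hmul : A * cfc f A = (x : ℝ) • cfc f A := by
    have h1 : cfc (fun y => y * f y) A = A * cfc f A := by
      rw [cfc_mul (fun y => y) f A continuousOn_id hf, cfc_id' ℝ A]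
    have h2 : cfc (fun y => x • f y) A = x • cfc f A := cfc_smul x f A hf
    rw [← h1, ← h2]
    congr 1
    ext y
    by_cases hyx : y = x <;> simp [f, hyx]
  obtain ⟨w, hw⟩ : ∃ w, cfc f A w ≠ 0 := by
    by_contra h
    push Not at h
    exact hne (ContinuousLinearMap.ext h)
  refine ⟨x, cfc f A w, hw, ?_⟩
  have := congrArg (fun T : K →L[ℂ] K => T w) hmul
  simpa using this

/-- A bounded self-adjoint operator with countable spectrum has a Hilbert basis of
eigenvectors. -/
theorem exists_eigenbasis_of_countable_spectrum {A : K →L[ℂ] K}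
    (hA : IsSelfAdjoint A) (hc : (_root_.spectrum ℝ A).Countable) :
    ∃ (S : Set K) (b : HilbertBasis S ℂ K) (r : S → ℝ), ∀ i, A (b i) = (r i : ℂ) • b i := by
  let P : Set (Set K) := {S | Orthonormal ℂ ((↑) : S → K) ∧ ∀ v ∈ S, ∃ r : ℝ, A v = (r : ℂ) • v}
  obtain ⟨S, hS⟩ : ∃ S, Maximal (· ∈ P) S := by
    refine zorn_subset P fun c hc hchain =>
      ⟨⋃₀ c, ⟨?_, ?_⟩, fun s hs => Set.subset_sUnion_of_mem hs⟩
    · exact orthonormal_sUnion_of_directed hchain.directedOn fun x hx => (hc hx).1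
    · rintro v ⟨s, hs, hv⟩
      exact (hc hs).2 v hv
  have hsym : ∀ v w : K, inner ℂ (A v) w = inner ℂ v (A w) :=
    ContinuousLinearMap.isSelfAdjoint_iff_isSymmetric.mp hA
  choose! r hr using hS.prop.2
  let N : Submodule ℂ K := (Submodule.span ℂ S)ᗮ
  have hmemN : ∀ {v : K}, v ∈ N ↔ ∀ e ∈ S, inner ℂ e v = 0 := by
    intro v
    constructor
    · intro h e he
      exact (Submodule.mem_orthogonal _ _).mp h _ (Submodule.subset_span he)
    · intro h
      rw [Submodule.mem_orthogonal]
      intro u hu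
      induction hu using Submodule.span_induction with
      | mem x hx => exact h x hx
      | zero => simp
      | add x y _ _ hx hy => rw [inner_add_left, hx, hy, add_zero]
      | smul c x _ hx => rw [inner_smul_left, hx, mul_zero]
  have hAN : ∀ v ∈ N, A v ∈ N := by
    intro v hv
    rw [hmemN] at hv ⊢
    intro e he
    rw [← hsym, hr e he, inner_smul_left, hv e he, mul_zero]
  -- Otherwise `A` restricted to `N` has an eigenvector, which could be adjoined to the maximal set
  -- `S`.
  have hN : N = ⊥ := by
    by_contra hbot
    have : Nontrivial N := Submodule.nontrivial_iff_ne_bot.mpr hbot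
    let AN : N →L[ℂ] N := (A.comp N.subtypeL).codRestrict N fun v => hAN v v.2
    have hANsa : IsSelfAdjoint AN := by
      rw [ContinuousLinearMap.isSelfAdjoint_iff_isSymmetric]
      intro v w
      exact hsym v w
    -- The inverse `B` of `z - A` also preserves `N`, since `z - A` acts on each `e ∈ S` as a
    -- nonzero scalar.
    have hsub : _root_.spectrum ℝ AN ⊆ _root_.spectrum ℝ A := by
      intro z hz
      by_contra hzA
      apply hz
      rw [spectrum.notMem_iff] at hzA
      obtain ⟨u, hu⟩ := hzA
      let B : K →L[ℂ] K := (u⁻¹ : (K →L[ℂ] K)ˣ)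
      have hBu : ∀ v, B (z • v - A v) = v := by
        intro v
        have := congrArg (fun T : K →L[ℂ] K => T v) u.inv_mul
        rw [hu] at this
        simpa [Algebra.algebraMap_eq_smul_one] using this
      have huB : ∀ v, z • B v - A (B v) = v := by
        intro v
        have := congrArg (fun T : K →L[ℂ] K => T v) u.mul_inv
        rw [hu] at this
        simpa [Algebra.algebraMap_eq_smul_one] using this
      have hBN : ∀ v ∈ N, B v ∈ N := by
        intro v hv
        rw [hmemN] at hv ⊢
        intro e he
        have h1 := hv e he
        have hne : ((z : ℂ) - r e) ≠ 0 := by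
          intro h0
          have h2 := hBu e
          rw [hr e he, ← Complex.coe_smul, ← sub_smul, h0, zero_smul, map_zero] at h2
          have h3 := hS.prop.1.norm_eq_one ⟨e, he⟩
          simp [← h2] at h3
        have h2 : inner ℂ e v = ((z : ℂ) - r e) * inner ℂ e (B v) := by
          conv_lhs => rw [← huB v]
          rw [inner_sub_right, ← hsym, hr e he, inner_smul_left, ← Complex.coe_smul,
            inner_smul_right, Complex.conj_ofReal, sub_mul]
        rw [h2] at h1
        exact (mul_eq_zero.mp h1).resolve_left hne
      let BN : N →L[ℂ] N := (B.comp N.subtypeL).codRestrict N fun v => hBN v v.2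
      refine ⟨⟨algebraMap ℝ _ z - AN, BN, ?_, ?_⟩, rfl⟩
      · ext v
        simp only [Algebra.algebraMap_eq_smul_one]
        exact huB v
      · ext v
        simp only [Algebra.algebraMap_eq_smul_one]
        exact hBu v
    obtain ⟨q, v, hv, hvq⟩ := exists_eigenvector_of_countable_spectrum hANsa (hc.mono hsub)
    let e : K := ((‖v‖⁻¹ : ℝ) : ℂ) • (v : K)
    have hv0 : ‖v‖ ≠ 0 := norm_ne_zero_iff.mpr hv
    have he1 : ‖e‖ = 1 := by
      simp only [e, norm_smul, Complex.norm_real, norm_inv, norm_norm]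
      exact inv_mul_cancel₀ hv0
    have heN : e ∈ N := N.smul_mem _ v.2
    have heA : A e = (q : ℂ) • e := by
      have h1 : A (v : K) = (q : ℂ) • (v : K) := congrArg Subtype.val hvq
      simp only [e, map_smul, h1]
      rw [smul_comm]
    have hins : insert e S ∈ P := by
      refine ⟨?_, ?_⟩
      · refine ⟨?_, ?_⟩
        · rintro ⟨w, rfl | hw⟩
          · exact he1
          · exact hS.prop.1.norm_eq_one ⟨w, hw⟩
        · rintro ⟨w, hw⟩ ⟨w', hw'⟩ hne
          have hne' : w ≠ w' := fun h => hne (Subtype.ext h)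
          change inner ℂ w w' = 0
          rcases hw with rfl | hw <;> rcases hw' with rfl | hw'
          · exact absurd rfl hne'
          · exact inner_eq_zero_symm.mp (hmemN.mp heN w' hw')
          · exact hmemN.mp heN w hw
          · exact hS.prop.1.inner_eq_zero (i := ⟨w, hw⟩) (j := ⟨w', hw'⟩)
              fun h => hne' (congrArg Subtype.val h)
      · rintro w (rfl | hw)
        · exact ⟨q, heA⟩
        · exact hS.prop.2 w hw
    have heS : e ∈ S := hS.le_of_ge hins (Set.subset_insert _ _) (Set.mem_insert _ _)
    have h0 := hmemN.mp heN e heS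
    rw [inner_self_eq_zero] at h0
    simp [h0] at he1
  refine ⟨S, HilbertBasis.mkOfOrthogonalEqBot hS.prop.1 (by rwa [Subtype.range_coe]),
    fun i => r i, fun i => ?_⟩
  simp only [HilbertBasis.coe_mkOfOrthogonalEqBot]
  exact hr i i.2

/-- A self-adjoint operator with countable spectrum has a Hilbert basis of eigenvectors. -/
theorem exists_eigenbasis {H : K →ₗ.[ℂ] K} (hH : IsSelfAdjoint H)
    (hσ : (spectrum H).Countable) :
    ∃ (S : Set K) (b : HilbertBasis S ℂ K) (l : S → ℝ),
      ∀ i, (b i, (l i : ℂ) • b i) ∈ H.graph := by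
  obtain ⟨x, hx⟩ : ∃ x : ℝ, (x : ℂ) ∉ spectrum H := by
    by_contra h
    push Not at h
    have h1 : (Set.range ((↑) : ℝ → ℂ)).Countable := hσ.mono (Set.range_subset_iff.mpr h)
    have := h1.to_subtype
    exact not_countable ((Equiv.ofInjective _ Complex.ofReal_injective).countable_iff.mpr this)
  obtain ⟨R, hR1, hR2⟩ := not_not.mp hx
  have hHH : H.IsFormalAdjoint H := by
    have := LinearPMap.adjoint_isFormalAdjoint hH.dense_domain
    rwa [LinearPMap.isSelfAdjoint_def.mp hH] at this
  have hRsa : IsSelfAdjoint R := by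
    rw [ContinuousLinearMap.isSelfAdjoint_iff_isSymmetric]
    intro v w
    change inner ℂ (R v) w = inner ℂ v (R w)
    obtain ⟨hv, hv'⟩ := hR1 v
    obtain ⟨hw, hw'⟩ := hR1 w
    have h := hHH ⟨R v, hv⟩ ⟨R w, hw⟩
    conv_lhs => rw [← hw']
    conv_rhs => rw [← hv']
    rw [inner_sub_right, inner_sub_left, inner_smul_left, inner_smul_right, Complex.conj_ofReal]
    rw [← h]
  -- Apart from `0`, the spectrum of `R` is carried into that of `H` by the injective map `m ↦ x +
  -- m⁻¹`.
  have hcount : (_root_.spectrum ℝ R).Countable := by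
    have h1 : _root_.spectrum ℝ R ⊆
        {0} ∪ (fun m : ℝ => (x : ℂ) + (m : ℂ)⁻¹) ⁻¹' spectrum H := by
      intro m hm
      by_cases hm0 : m = 0
      · exact Or.inl hm0
      · have hm' : (m : ℂ) ∈ _root_.spectrum ℂ R := (spectrum.algebraMap_mem_iff ℂ).mpr hm
        exact Or.inr (spectrum_resolvent_subset hR1 hR2 hm' (by exact_mod_cast hm0))
    refine Set.Countable.mono h1 ((Set.countable_singleton 0).union (hσ.preimage ?_))
    intro m m' h
    simpa using h
  obtain ⟨S, b, r, hb⟩ := exists_eigenbasis_of_countable_spectrum hRsa hcount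
  -- As `R` inverts `H - x`, an eigenvalue `r` of `R` belongs to the eigenvalue `x + r⁻¹` of `H`;
  -- `r` is nonzero because `R` is injective.
  refine ⟨S, b, fun i => x + (r i)⁻¹, fun i => ?_⟩
  have hr0 : (r i : ℂ) ≠ 0 := by
    intro h0
    obtain ⟨h, hw⟩ := hR1 (b i)
    have hz : R (b i) = 0 := by rw [hb, h0, zero_smul]
    have : H ⟨R (b i), h⟩ = 0 := by
      have e : (⟨R (b i), h⟩ : H.domain) = 0 := Subtype.ext hz
      rw [e, LinearPMap.map_zero]
    rw [this, hz, smul_zero, sub_zero] at hw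
    have := b.orthonormal.norm_eq_one i
    simp [← hw] at this
  obtain ⟨h, hw⟩ := hR1 (b i)
  have hg : (R (b i), H ⟨R (b i), h⟩) ∈ H.graph := H.mem_graph ⟨R (b i), h⟩
  have hg' := H.graph.smul_mem ((r i : ℂ)⁻¹) hg
  rw [sub_eq_iff_eq_add] at hw
  rw [hw, hb, Prod.smul_mk, smul_add, smul_smul, smul_smul, smul_smul, inv_mul_cancel₀ hr0,
    one_smul] at hg'
  convert! hg' using 2
  rw [← add_smul]
  congr 1
  push_cast
  field_simp
  ring

end CountableSpectrum

/-! ### The Gaussian as a Schwartz function -/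

section Gaussian

variable (V : Type*) [NormedAddCommGroup V] [InnerProductSpace ℝ V]

theorem exists_pow_mul_exp_neg_le (k : ℕ) :
    ∃ C : ℝ, ∀ t : ℝ, 0 ≤ t → (1 + t) ^ k * Real.exp (-(t ^ 2 / 2)) ≤ C := by
  refine ⟨k.factorial * Real.exp 2, fun t ht => ?_⟩
  have h1 : (1 + t) ^ k ≤ k.factorial * Real.exp (1 + t) := by
    have := Real.pow_div_factorial_le_exp (1 + t) (by positivity) k
    rwa [div_le_iff₀ (by positivity), mul_comm] at this
  calc (1 + t) ^ k * Real.exp (-(t ^ 2 / 2))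
      ≤ k.factorial * Real.exp (1 + t) * Real.exp (-(t ^ 2 / 2)) := by gcongr
    _ = k.factorial * Real.exp (1 + t - t ^ 2 / 2) := by
      rw [mul_assoc, ← Real.exp_add, sub_eq_add_neg]
    _ ≤ k.factorial * Real.exp 2 := by
      gcongr
      nlinarith [sq_nonneg (t - 1)]

theorem norm_iteratedFDeriv_exp (i : ℕ) (t : ℝ) :
    ‖iteratedFDeriv ℝ i Real.exp t‖ = Real.exp t := by
  rw [norm_iteratedFDeriv_eq_norm_iteratedDeriv, iteratedDeriv_eq_iterate, Real.iter_deriv_exp,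
    Real.norm_eq_abs, Real.abs_exp]

/-- All derivatives of `exp` are `exp`, so the bound for derivatives of a composition yields a
polynomial factor times the Gaussian itself. -/
theorem exists_norm_iteratedFDeriv_gaussian_le (k i : ℕ) :
    ∃ C : ℝ, ∀ x : V,
      ‖x‖ ^ k * ‖iteratedFDeriv ℝ i (fun x : V => Real.exp (-(‖x‖ ^ 2 / 2))) x‖ ≤ C := by
  have hf : (fun x : V => -(‖x‖ ^ 2 / 2)).HasTemperateGrowth := by
    have h1 : (fun x : V => ‖x‖ ^ 2).HasTemperateGrowth :=
      Function.hasTemperateGrowth_norm_sq V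
    have h2 := (Function.HasTemperateGrowth.const (E := V) (-(1 / 2) : ℝ)).mul h1
    convert! h2 using 1
    ext x
    simp
    ring
  obtain ⟨q, B, hB0, hB⟩ := hf.norm_iteratedFDeriv_le_uniform i
  obtain ⟨C, hC⟩ := exists_pow_mul_exp_neg_le (k + q * i)
  refine ⟨i.factorial * (1 + B) ^ i * C, fun x => ?_⟩
  -- The composition bound wants `D ^ j` for the `j`-th derivative; `D ≤ D ^ j` for `j ≥ 1` needs `D
  -- ≥ 1`, whence `1 + B` rather than `B`.
  have hD1 : 1 ≤ (1 + B) * (1 + ‖x‖) ^ q := by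
    have : 1 ≤ (1 + ‖x‖) ^ q := one_le_pow₀ (by linarith [norm_nonneg x])
    nlinarith
  have hcomp := norm_iteratedFDeriv_comp_le (𝕜 := ℝ) (n := i) (N := i)
    (C := Real.exp (-(‖x‖ ^ 2 / 2))) (D := (1 + B) * (1 + ‖x‖) ^ q)
    Real.contDiff_exp (hf.1.of_le (by exact_mod_cast le_top))
    le_rfl x (fun j _ => (norm_iteratedFDeriv_exp j _).le) (fun j hj1 hji => by
      refine (hB j hji x).trans ?_
      refine le_trans ?_ (le_self_pow₀ hD1 (by omega))
      gcongr
      linarith)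
  calc ‖x‖ ^ k * ‖iteratedFDeriv ℝ i (fun x : V => Real.exp (-(‖x‖ ^ 2 / 2))) x‖
      ≤ (1 + ‖x‖) ^ k * (i.factorial * Real.exp (-(‖x‖ ^ 2 / 2)) *
          ((1 + B) * (1 + ‖x‖) ^ q) ^ i) := by
        gcongr
        · linarith
        · exact hcomp
    _ = i.factorial * (1 + B) ^ i *
          ((1 + ‖x‖) ^ (k + q * i) * Real.exp (-(‖x‖ ^ 2 / 2))) := by
        rw [mul_pow, ← pow_mul, pow_add]
        ring
    _ ≤ i.factorial * (1 + B) ^ i * C := by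
        gcongr
        exact hC _ (norm_nonneg x)

/-- The Gaussian `exp (-‖x‖² / 2)`. -/
def gaussian : 𝓢(V, ℂ) where
  toFun x := ((Real.exp (-(‖x‖ ^ 2 / 2)) : ℝ) : ℂ)
  smooth' := by
    have h : ContDiff ℝ ∞ fun x : V => Real.exp (-(‖x‖ ^ 2 / 2)) :=
      Real.contDiff_exp.comp ((contDiff_norm_sq ℝ).div_const 2).neg
    exact Complex.ofRealCLM.contDiff.comp h
  decay' k i := by
    have h : ContDiff ℝ i fun x : V => Real.exp (-(‖x‖ ^ 2 / 2)) :=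
      Real.contDiff_exp.comp ((contDiff_norm_sq ℝ).div_const 2).neg
    obtain ⟨C, hC⟩ := exists_norm_iteratedFDeriv_gaussian_le V k i
    refine ⟨C, fun x => ?_⟩
    have e := Complex.ofRealLI.norm_iteratedFDeriv_comp_left (h.contDiffAt (x := x)) le_rfl
    have e' : (fun x : V => ((Real.exp (-(‖x‖ ^ 2 / 2)) : ℝ) : ℂ)) =
      Complex.ofRealLI ∘ fun x : V => Real.exp (-(‖x‖ ^ 2 / 2)) := rfl
    rw [e', e]
    exact hC x

@[simp]
theorem gaussian_apply (x : V) : gaussian V x = ((Real.exp (-(‖x‖ ^ 2 / 2)) : ℝ) : ℂ) := rfl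

end Gaussian

/-! ### Ladder operators -/

section Ladder

variable {n : ℕ}

local notation "𝒮" => 𝓢(EuclideanSpace ℝ (Fin n), ℂ)

theorem hasFDerivAt_coord (j : Fin n) (x : EuclideanSpace ℝ (Fin n)) :
    HasFDerivAt (fun x : EuclideanSpace ℝ (Fin n) => ((x j : ℝ) : ℂ))
      (Complex.ofRealCLM.comp (EuclideanSpace.proj (𝕜 := ℝ) j)) x :=
  (Complex.ofRealCLM.comp (EuclideanSpace.proj (𝕜 := ℝ) j)).hasFDerivAt

theorem commute_position (j k : Fin n) :
    Commute (position (n := n) j) (position k) := by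
  ext φ x
  simp only [Module.End.mul_apply, position_apply]
  ring

theorem commute_momentum (j k : Fin n) :
    Commute (momentum (n := n) j) (momentum k) := by
  have key : ∀ (φ : 𝒮) (x : EuclideanSpace ℝ (Fin n)) (j k : Fin n),
      momentum j (momentum k φ) x = -fderiv ℝ (fderiv ℝ φ) x (EuclideanSpace.single j 1)
        (EuclideanSpace.single k 1) := by
    intro φ x j k
    have hd : DifferentiableAt ℝ (fderiv ℝ φ) x :=
      ((φ.smooth 2).fderiv_right (m := 1) (by norm_num)).differentiable one_ne_zero x
    have h1 : HasFDerivAt (fun y => fderiv ℝ φ y (EuclideanSpace.single k 1)) _ x :=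
      hd.hasFDerivAt.clm_apply (hasFDerivAt_const (EuclideanSpace.single k (1 : ℝ)) x)
    have e : (momentum k φ : EuclideanSpace ℝ (Fin n) → ℂ) =
        fun y => -Complex.I * fderiv ℝ φ y (EuclideanSpace.single k 1) :=
      funext fun y => momentum_apply k φ y
    rw [momentum_apply, e, (h1.const_mul (-Complex.I)).fderiv]
    simp [← mul_assoc]
  ext φ x
  have hsym : IsSymmSndFDerivAt ℝ φ x :=
    (φ.smooth 2).contDiffAt.isSymmSndFDerivAt (by simp)
  rw [Module.End.mul_apply, Module.End.mul_apply, key, key, hsym.eq]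

/-- The canonical commutation relation, from the Leibniz rule; the ladder algebra below uses only
this and the commutation of positions and of momenta. -/
theorem momentum_mul_position (j k : Fin n) :
    momentum (n := n) j * position k =
      position k * momentum j - (if j = k then Complex.I else 0) • 1 := by
  ext φ x
  have e : (position k φ : EuclideanSpace ℝ (Fin n) → ℂ) = (fun x => ((x k : ℝ) : ℂ)) * ⇑φ :=
    funext fun x => position_apply k φ x
  have h1 := (hasFDerivAt_coord k x).mul (φ.hasFDerivAt x)
  have h2 : (EuclideanSpace.single j (1 : ℝ) : EuclideanSpace ℝ (Fin n)) k =
      if j = k then 1 else 0 := by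
    simp [eq_comm]
  rw [Module.End.mul_apply, LinearMap.sub_apply, LinearMap.smul_apply, Module.End.mul_apply,
    Module.End.one_apply, momentum_apply, e, h1.fderiv]
  simp only [sub_apply, smul_apply, position_apply, momentum_apply]
  by_cases hjk : j = k
  · simp [hjk]
    ring
  · simp [hjk]
    ring

/-- The annihilation operator `X_j + i P_j`. -/
def lower (j : Fin n) : Module.End ℂ 𝒮 := position j + Complex.I • momentum j

/-- The creation operator `X_j - i P_j`. -/
def raise (j : Fin n) : Module.End ℂ 𝒮 := position j - Complex.I • momentum j

/-- The number operator of the `j`-th degree of freedom. -/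
def number (j : Fin n) : Module.End ℂ 𝒮 := (2⁻¹ : ℂ) • (raise j * lower j)

theorem commute_raise (j k : Fin n) : Commute (raise (n := n) j) (raise k) := by
  have h1 := (commute_position (n := n) j k).eq
  have h2 := (commute_momentum (n := n) j k).eq
  have h3 := momentum_mul_position (n := n) j k
  have h4 := momentum_mul_position (n := n) k j
  rw [commute_iff_eq]
  simp only [raise, sub_mul, mul_sub, smul_mul_assoc, mul_smul_comm, h1, h2, h3, h4,
    eq_comm (a := k)]
  module

theorem lower_mul_raise (j k : Fin n) :
    lower (n := n) k * raise j = raise j * lower k + (if j = k then 2 else 0 : ℂ) • 1 := by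
  have h1 := (commute_position (n := n) k j).eq
  have h2 := (commute_momentum (n := n) k j).eq
  have h3 := momentum_mul_position (n := n) j k
  have h4 := momentum_mul_position (n := n) k j
  simp only [raise, lower, sub_mul, mul_sub, add_mul, mul_add, smul_mul_assoc, mul_smul_comm, h1,
    h2, h3, h4, eq_comm (a := k)]
  have h5 := Complex.I_mul_I
  split_ifs
  · linear_combination (norm := module) (-(2 : ℂ) * h5) • (1 : Module.End ℂ 𝒮)
  · module

theorem number_mul_raise (j k : Fin n) :
    number (n := n) k * raise j =
      raise j * number k + (if j = k then 1 else 0 : ℂ) • raise j := by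
  have h := lower_mul_raise (n := n) j k
  have hc := (commute_raise (n := n) k j).eq
  rw [number, smul_mul_assoc, mul_assoc, h, mul_add, mul_smul_comm, mul_one, ← mul_assoc, hc,
    mul_assoc, mul_smul_comm]
  split_ifs with hjk
  · subst hjk
    module
  · module

/-- The `-1` is the commutator term. It makes the eigenvalues natural numbers and reappears in
`numberSymbol`. -/
theorem two_smul_number (j : Fin n) :
    (2 : ℂ) • number (n := n) j = position j ^ 2 + momentum j ^ 2 - 1 := by
  have h3 := momentum_mul_position (n := n) j j
  rw [if_pos rfl] at h3
  simp only [number, raise, lower, sub_mul, mul_add, smul_mul_assoc, mul_smul_comm, h3, sq]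
  have h5 := Complex.I_mul_I
  linear_combination (norm := module) h5 • (1 : Module.End ℂ 𝒮) - h5 • (momentum j * momentum j)

theorem lower_gaussian (j : Fin n) : lower j (gaussian (EuclideanSpace ℝ (Fin n))) = 0 := by
  ext x
  have h1 : HasFDerivAt (fun x : EuclideanSpace ℝ (Fin n) => Real.exp (-(2⁻¹ * ‖x‖ ^ 2))) _ x :=
    ((((hasStrictFDerivAt_norm_sq x).hasFDerivAt).const_mul 2⁻¹).neg).exp
  have h2 := Complex.ofRealCLM.hasFDerivAt.comp x h1
  have e : (gaussian (EuclideanSpace ℝ (Fin n)) : EuclideanSpace ℝ (Fin n) → ℂ) =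
      Complex.ofRealCLM ∘ fun x => Real.exp (-(2⁻¹ * ‖x‖ ^ 2)) := by
    ext y
    simp [div_eq_inv_mul]
  rw [lower, LinearMap.add_apply, LinearMap.smul_apply, add_apply, smul_apply, position_apply,
    momentum_apply, e, h2.fderiv]
  simp [← mul_assoc, EuclideanSpace.inner_single_right]
  ring

end Ladder

section Hermite

variable {n : ℕ}

local notation "𝒮" => 𝓢(EuclideanSpace ℝ (Fin n), ℂ)

/-! ### Symmetry of position and momentum -/

theorem inner_toLp (φ ψ : 𝒮) :
    inner ℂ (φ.toLp 2 volume) (ψ.toLp 2 volume) = ∫ x, starRingEnd ℂ (φ x) * ψ x := by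
  rw [SchwartzMap.inner_toL2_toL2_eq _ _ volume]
  simp [RCLike.inner_apply, mul_comm]

theorem toLp_add (φ ψ : 𝒮) :
    (φ + ψ).toLp 2 volume = (φ.toLp 2 volume + ψ.toLp 2 volume : L2 n) := rfl

theorem toLp_smul (c : ℂ) (φ : 𝒮) : (c • φ).toLp 2 volume = (c • φ.toLp 2 volume : L2 n) := rfl

theorem inner_position (j : Fin n) (φ ψ : 𝒮) :
    inner ℂ ((position j φ).toLp 2 volume) (ψ.toLp 2 volume) =
      inner ℂ (φ.toLp 2 volume) ((position j ψ).toLp 2 volume) := by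
  rw [inner_toLp, inner_toLp]
  congr 1
  ext x
  simp [position_apply]
  ring

/-- Integration by parts; its sign is absorbed by conjugating `-i`. -/
theorem inner_momentum (j : Fin n) (φ ψ : 𝒮) :
    inner ℂ ((momentum j φ).toLp 2 volume) (ψ.toLp 2 volume) =
      inner ℂ (φ.toLp 2 volume) ((momentum j ψ).toLp 2 volume) := by
  rw [inner_toLp, inner_toLp]
  have h := SchwartzMap.integral_bilinear_lineDerivOp_right_eq_neg_left (μ := volume) φ ψ
    ((ContinuousLinearMap.mul ℝ ℂ).comp (Complex.conjCLE : ℂ →L[ℝ] ℂ))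
    (EuclideanSpace.single j (1 : ℝ))
  simp only [SchwartzMap.lineDerivOp_apply_eq_fderiv, ContinuousLinearMap.comp_apply,
    ContinuousLinearMap.mul_apply'] at h
  have e1 : ∀ x, starRingEnd ℂ (momentum j φ x) * ψ x = Complex.I *
      (starRingEnd ℂ (fderiv ℝ φ x (EuclideanSpace.single j 1)) * ψ x) := by
    intro x
    rw [momentum_apply]
    simp
    ring
  have e2 : ∀ x, starRingEnd ℂ (φ x) * momentum j ψ x = -Complex.I *
      (starRingEnd ℂ (φ x) * fderiv ℝ ψ x (EuclideanSpace.single j 1)) := by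
    intro x
    rw [momentum_apply]
    ring
  simp only [e1, e2, integral_const_mul]
  rw [neg_mul, ← mul_neg]
  congr 1
  rw [eq_neg_iff_add_eq_zero, add_comm, ← eq_neg_iff_add_eq_zero]
  exact h

theorem inner_lower (j : Fin n) (φ ψ : 𝒮) :
    inner ℂ ((lower j φ).toLp 2 volume) (ψ.toLp 2 volume) =
      inner ℂ (φ.toLp 2 volume) ((raise j ψ).toLp 2 volume) := by
  have e1 : (lower j φ).toLp 2 volume =
      ((position j φ).toLp 2 volume + Complex.I • (momentum j φ).toLp 2 volume : L2 n) := rfl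
  have e2 : (raise j ψ).toLp 2 volume =
      ((position j ψ).toLp 2 volume - Complex.I • (momentum j ψ).toLp 2 volume : L2 n) := rfl
  rw [e1, e2, inner_add_left, inner_sub_right, inner_smul_left, inner_smul_right, inner_position,
    inner_momentum]
  simp
  ring

theorem inner_raise (j : Fin n) (φ ψ : 𝒮) :
    inner ℂ ((raise j φ).toLp 2 volume) (ψ.toLp 2 volume) =
      inner ℂ (φ.toLp 2 volume) ((lower j ψ).toLp 2 volume) := by
  rw [← inner_conj_symm, ← inner_lower, inner_conj_symm]

theorem inner_number (j : Fin n) (φ ψ : 𝒮) :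
    inner ℂ ((number j φ).toLp 2 volume) (ψ.toLp 2 volume) =
      inner ℂ (φ.toLp 2 volume) ((number j ψ).toLp 2 volume) := by
  have e : ∀ χ : 𝒮, (number j χ).toLp 2 volume =
      ((2⁻¹ : ℂ) • (raise j (lower j χ)).toLp 2 volume : L2 n) :=
    fun _ => rfl
  rw [e, e, inner_smul_left, inner_smul_right, inner_raise, inner_lower, map_inv₀,
    Complex.conj_ofNat]

/-! ### Hermite functions -/

theorem pairwise_commute_powersHom_raise :
    Pairwise fun j k : Fin n => ∀ x y, Commute (powersHom (Module.End ℂ 𝒮) (raise j) x)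
      (powersHom (Module.End ℂ 𝒮) (raise k) y) := by
  intro j k _ x y
  simpa [powersHom_apply] using (commute_raise j k).pow_pow _ _

/-- The product of powers of creation operators. -/
def raisePow : (Fin n → Multiplicative ℕ) →* Module.End ℂ 𝒮 :=
  MonoidHom.noncommPiCoprod (fun j => powersHom _ (raise j)) pairwise_commute_powersHom_raise

/-- The (unnormalized) Hermite functions. -/
def hermite (m : Fin n → ℕ) : 𝒮 :=
  raisePow (fun j => Multiplicative.ofAdd (m j)) (gaussian _)

theorem hermite_zero : hermite (0 : Fin n → ℕ) = gaussian _ := by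
  have h : (fun j => Multiplicative.ofAdd ((0 : Fin n → ℕ) j)) = 1 := rfl
  rw [hermite, h, map_one]
  rfl

theorem hermite_add_single (m : Fin n → ℕ) (j : Fin n) :
    hermite (m + Pi.single j 1) = raise j (hermite m) := by
  have h : (fun k => Multiplicative.ofAdd ((m + Pi.single j 1 : Fin n → ℕ) k)) =
      Pi.mulSingle j (Multiplicative.ofAdd 1) * fun k => Multiplicative.ofAdd (m k) := by
    ext k
    by_cases hk : k = j
    · subst hk
      simp [mul_comm]
    · simp [hk]
  rw [hermite, h, map_mul, Module.End.mul_apply, hermite]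
  congr 1
  rw [raisePow, MonoidHom.noncommPiCoprod_mulSingle]
  simp

theorem multiIndex_induction {p : (Fin n → ℕ) → Prop} (h0 : p 0)
    (hs : ∀ m j, p m → p (m + Pi.single j 1)) (m : Fin n → ℕ) : p m := by
  induction hk : ∑ j, m j generalizing m with
  | zero =>
    have : m = 0 := by
      ext j
      exact Finset.sum_eq_zero_iff.mp hk j (Finset.mem_univ j)
    rwa [this]
  | succ k ih =>
    obtain ⟨j, -, hj⟩ : ∃ j ∈ Finset.univ, m j ≠ 0 := by
      apply Finset.exists_ne_zero_of_sum_ne_zero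
      omega
    have hm : m = (m - Pi.single j 1) + Pi.single j 1 := by
      refine (tsub_add_cancel_of_le ?_).symm
      intro i
      by_cases hi : i = j
      · subst hi
        simpa using Nat.one_le_iff_ne_zero.mpr hj
      · simp [hi]
    rw [hm]
    apply hs
    apply ih
    rw [hm] at hk
    simp only [Pi.add_apply, Finset.sum_add_distrib, Finset.sum_pi_single', Finset.mem_univ,
      if_true] at hk
    simpa using hk

/-- The Gaussian is annihilated by every `lower k`, and each creation operator raises its own number
eigenvalue by one. -/
theorem number_hermite (k : Fin n) (m : Fin n → ℕ) :
    number k (hermite m) = (m k : ℂ) • hermite m := by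
  induction m using multiIndex_induction with
  | h0 => simp [hermite_zero, number, lower_gaussian]
  | hs m j ih =>
    have h := congrArg (fun T : Module.End ℂ 𝒮 => T (hermite m)) (number_mul_raise j k)
    simp only [Module.End.mul_apply, LinearMap.add_apply, LinearMap.smul_apply, ih, map_smul] at h
    rw [hermite_add_single, h]
    by_cases hjk : j = k
    · subst hjk
      simp [add_smul]
    · simp [hjk, Ne.symm hjk]

/-- If `raise j` killed `hermite m`, then applying `lower j` would give `(2 m_j + 2) hermite m = 0`.
-/
theorem hermite_ne_zero (m : Fin n → ℕ) : hermite m ≠ 0 := by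
  induction m using multiIndex_induction with
  | h0 =>
    intro h
    have := congrArg (fun φ : 𝒮 => φ 0) h
    simp [hermite_zero] at this
  | hs m j ih =>
    intro h
    rw [hermite_add_single] at h
    have h1 := congrArg (fun T : Module.End ℂ 𝒮 => T (hermite m)) (lower_mul_raise j j)
    have h2 : raise j (lower j (hermite m)) = (2 * m j : ℂ) • hermite m := by
      rw [mul_smul, ← number_hermite, number, LinearMap.smul_apply, smul_smul]
      simp
    simp only [Module.End.mul_apply, LinearMap.add_apply, LinearMap.smul_apply, h, map_zero, h2,
      Module.End.one_apply, if_true] at h1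
    rw [← add_smul, eq_comm, smul_eq_zero] at h1
    refine h1.elim (fun h3 => ?_) ih
    norm_cast at h3

theorem toLp_hermite_ne_zero (m : Fin n → ℕ) : ((hermite m).toLp 2 volume : L2 n) ≠ 0 := by
  intro h
  exact hermite_ne_zero m (SchwartzMap.injective_toLp 2 volume h)

/-- The normalized Hermite functions. -/
def hermiteFun (m : Fin n → ℕ) : 𝒮 :=
  ((‖((hermite m).toLp 2 volume : L2 n)‖⁻¹ : ℝ) : ℂ) • hermite m

theorem number_hermiteFun (k : Fin n) (m : Fin n → ℕ) :
    number k (hermiteFun m) = (m k : ℂ) • hermiteFun m := by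
  rw [hermiteFun, map_smul, number_hermite, smul_comm]

/-- Distinct multi-indices differ in some `j`, so the functions have different eigenvalues for the
symmetric operator `number j`. -/
theorem orthonormal_hermiteFun :
    Orthonormal ℂ fun m : Fin n → ℕ => ((hermiteFun m).toLp 2 volume : L2 n) := by
  constructor
  · intro m
    simp only [hermiteFun, toLp_smul, norm_smul]
    simp only [Complex.norm_real, norm_inv, norm_norm]
    exact inv_mul_cancel₀ (norm_ne_zero_iff.mpr (toLp_hermite_ne_zero m))
  · intro m m' hne
    obtain ⟨j, hj⟩ := Function.ne_iff.mp hne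
    have h := inner_number j (hermiteFun m) (hermiteFun m')
    rw [number_hermiteFun, number_hermiteFun, toLp_smul, toLp_smul, inner_smul_left,
      inner_smul_right, Complex.conj_natCast, ← sub_eq_zero, ← sub_mul, mul_eq_zero] at h
    refine h.resolve_left fun h0 => hj ?_
    exact_mod_cast sub_eq_zero.mp h0

/-! ### Completeness of the Hermite functions -/

theorem raise_mem_span (j : Fin n) {φ : 𝒮}
    (h : φ ∈ Submodule.span ℂ (Set.range (hermite (n := n)))) :
    raise j φ ∈ Submodule.span ℂ (Set.range (hermite (n := n))) := by
  induction h using Submodule.span_induction with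
  | mem x hx =>
    obtain ⟨m, rfl⟩ := hx
    rw [← hermite_add_single]
    exact Submodule.subset_span ⟨_, rfl⟩
  | zero => simp
  | add x y _ _ hx hy => rw [map_add]; exact Submodule.add_mem _ hx hy
  | smul c x _ hx => rw [map_smul]; exact Submodule.smul_mem _ _ hx

theorem lower_mem_span (j : Fin n) {φ : 𝒮}
    (h : φ ∈ Submodule.span ℂ (Set.range (hermite (n := n)))) :
    lower j φ ∈ Submodule.span ℂ (Set.range (hermite (n := n))) := by
  induction h using Submodule.span_induction with
  | mem x hx =>
    obtain ⟨m, rfl⟩ := hx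
    induction m using multiIndex_induction with
    | h0 => simp [hermite_zero, lower_gaussian]
    | hs m k ih =>
      have h1 := congrArg (fun T : Module.End ℂ 𝒮 => T (hermite m)) (lower_mul_raise k j)
      simp only [Module.End.mul_apply, LinearMap.add_apply, LinearMap.smul_apply,
        Module.End.one_apply] at h1
      rw [hermite_add_single, h1]
      exact Submodule.add_mem _ (raise_mem_span k ih)
        (Submodule.smul_mem _ _ (Submodule.subset_span ⟨_, rfl⟩))
  | zero => simp
  | add x y _ _ hx hy => rw [map_add]; exact Submodule.add_mem _ hx hy
  | smul c x _ hx => rw [map_smul]; exact Submodule.smul_mem _ _ hx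

theorem position_mem_span (j : Fin n) {φ : 𝒮}
    (h : φ ∈ Submodule.span ℂ (Set.range (hermite (n := n)))) :
    position j φ ∈ Submodule.span ℂ (Set.range (hermite (n := n))) := by
  have e : position j φ = (2⁻¹ : ℂ) • (lower j φ + raise j φ) := by
    simp only [lower, raise, LinearMap.add_apply, LinearMap.sub_apply, LinearMap.smul_apply]
    module
  rw [e]
  exact Submodule.smul_mem _ _ (Submodule.add_mem _ (lower_mem_span j h) (raise_mem_span j h))

/-- The powers of a linear form times the Gaussian are spanned by the Hermite functions. -/
theorem exists_mem_span_eq_inner_pow_mul_gaussian (ξ : EuclideanSpace ℝ (Fin n)) (k : ℕ) :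
    ∃ φ ∈ Submodule.span ℂ (Set.range (hermite (n := n))),
      ∀ x, φ x = ((inner ℝ ξ x : ℝ) : ℂ) ^ k * gaussian _ x := by
  induction k with
  | zero => exact ⟨gaussian _, hermite_zero (n := n) ▸ Submodule.subset_span ⟨0, rfl⟩, by simp⟩
  | succ k ih =>
    obtain ⟨φ, hφ, h⟩ := ih
    refine ⟨∑ j, ((ξ j : ℝ) : ℂ) • position j φ, Submodule.sum_mem _ fun j _ =>
      Submodule.smul_mem _ _ (position_mem_span j hφ), fun x => ?_⟩
    simp only [sum_apply, smul_apply, position_apply, h]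
    rw [pow_succ', PiLp.inner_apply]
    push_cast
    rw [Finset.sum_mul, Finset.sum_mul]
    refine Finset.sum_congr rfl fun j _ => ?_
    simp
    ring

end Hermite

/-! ### Completeness by way of moments and the Fourier transform -/

section Completeness

open scoped FourierTransform RealInnerProductSpace

/-- An integrable function whose Fourier transform vanishes is zero almost everywhere. -/
theorem ae_eq_zero_of_fourier_eq_zero {V : Type*} [NormedAddCommGroup V] [InnerProductSpace ℝ V]
    [FiniteDimensional ℝ V] [MeasurableSpace V] [BorelSpace V] {h : V → ℂ} (hh : Integrable h)
    (h0 : ∀ w, 𝓕 h w = 0) : ∀ᵐ x, h x = 0 := by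
  refine ae_eq_zero_of_integral_contDiff_smul_eq_zero hh.locallyIntegrable fun g hg hgc => ?_
  have hc : HasCompactSupport fun x => (g x : ℂ) := hgc.comp_left Complex.ofReal_zero
  have hs : ContDiff ℝ ∞ fun x => (g x : ℂ) := Complex.ofRealCLM.contDiff.comp hg
  let G : 𝓢(V, ℂ) := hc.toSchwartzMap hs
  have hG : ∀ x, 𝓕 (𝓕⁻ G) x = (g x : ℂ) := by
    intro x
    rw [FourierTransform.fourier_fourierInv_eq]
    rfl
  -- The test function is itself a Fourier transform, so the transform can be moved onto `h`, where
  -- it vanishes.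
  have key : ∫ ξ, 𝓕 (𝓕⁻ G) ξ * h ξ = ∫ x, (𝓕⁻ G) x * 𝓕 h x := by
    have := VectorFourier.integral_bilin_fourierIntegral_eq_flip (ContinuousLinearMap.mul ℂ ℂ)
      (L := innerₗ V) Real.continuous_fourierChar continuous_inner
      ((𝓕⁻ G).integrable (μ := volume)) hh
    rw [flip_innerₗ] at this
    exact this
  simp only [hG, h0, mul_zero, integral_zero] at key
  simpa using key

/-- A function with exponential moments, all of whose polynomial moments vanish, has vanishing
Fourier transform. -/
theorem fourier_eq_zero_of_moments_eq_zero {V : Type*} [NormedAddCommGroup V]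
    [InnerProductSpace ℝ V] [FiniteDimensional ℝ V] [MeasurableSpace V] [BorelSpace V] {h : V → ℂ}
    (hmeas : AEStronglyMeasurable h volume)
    (hint : ∀ ξ : V, Integrable fun x => Real.exp |⟪ξ, x⟫| * ‖h x‖)
    (hmoment : ∀ (ξ : V) (k : ℕ), ∫ x, ((⟪ξ, x⟫ : ℝ) : ℂ) ^ k * h x = 0) (w : V) :
    𝓕 h w = 0 := by
  let c : ℂ := -(2 * Real.pi) * Complex.I
  have hc : ‖c‖ = 2 * Real.pi := by simp [c, abs_of_pos Real.pi_pos]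
  -- The Fourier integral is expanded in the exponential series. The `F k` are its terms, with zero
  -- integral by the moment hypothesis; the bounds `B k` sum to an exponential moment, which permits
  -- termwise integration.
  let F : ℕ → V → ℂ := fun k x => (c * ((⟪w, x⟫ : ℝ) : ℂ)) ^ k / (k.factorial : ℂ) * h x
  let B : ℕ → V → ℝ := fun k x => |⟪(2 * Real.pi) • w, x⟫| ^ k / k.factorial * ‖h x‖
  have hF : ∀ k, AEStronglyMeasurable (F k) volume := by
    intro k
    have : Continuous fun x : V => (c * ((⟪w, x⟫ : ℝ) : ℂ)) ^ k / (k.factorial : ℂ) := by fun_prop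
    exact this.aestronglyMeasurable.mul hmeas
  have hFB : ∀ k x, ‖F k x‖ ≤ B k x := by
    intro k x
    simp only [F, B]
    rw [norm_mul, norm_div, norm_pow, norm_mul, hc, real_inner_smul_left, abs_mul,
      abs_of_pos Real.two_pi_pos, Complex.norm_real, Complex.norm_natCast, Real.norm_eq_abs]
  have hB : ∀ x, HasSum (fun k => B k x) (Real.exp |⟪(2 * Real.pi) • w, x⟫| * ‖h x‖) := by
    intro x
    refine HasSum.mul_right _ ?_
    rw [Real.exp_eq_exp_ℝ]
    exact NormedSpace.expSeries_div_hasSum_exp _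
  have hlim : ∀ x, HasSum (fun k => F k x) (Complex.exp (c * ((⟪w, x⟫ : ℝ) : ℂ)) * h x) := by
    intro x
    refine HasSum.mul_right _ ?_
    rw [Complex.exp_eq_exp_ℂ]
    exact NormedSpace.expSeries_div_hasSum_exp _
  have hBint : Integrable fun x => ∑' k, B k x := by
    simp only [fun x => (hB x).tsum_eq]
    exact hint _
  have hsum := hasSum_integral_of_dominated_convergence B hF (fun k => ae_of_all _ (hFB k))
    (ae_of_all _ fun x => (hB x).summable) hBint (ae_of_all _ hlim)
  have hz : ∀ k : ℕ, ∫ x, F k x = 0 := by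
    intro k
    have e : ∀ x, F k x = (c ^ k / (k.factorial : ℂ)) * (((⟪w, x⟫ : ℝ) : ℂ) ^ k * h x) := by
      intro x
      simp only [F]
      rw [mul_pow]
      ring
    simp only [e, integral_const_mul, hmoment, mul_zero]
  simp only [hz] at hsum
  have hzero := hsum.unique hasSum_zero
  rw [Real.fourier_eq', ← hzero]
  congr 1
  ext x
  rw [smul_eq_mul, real_inner_comm]
  congr 2
  simp [c]
  ring

variable {n : ℕ}

theorem memLp_exp_inner_mul_gaussian (ξ : EuclideanSpace ℝ (Fin n)) :
    MemLp (fun x : EuclideanSpace ℝ (Fin n) => Real.exp ⟪ξ, x⟫ * Real.exp (-(‖x‖ ^ 2 / 2))) 2 := by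
  have hcont : Continuous fun x : EuclideanSpace ℝ (Fin n) =>
      Real.exp ⟪ξ, x⟫ * Real.exp (-(‖x‖ ^ 2 / 2)) := by fun_prop
  rw [memLp_two_iff_integrable_sq hcont.aestronglyMeasurable]
  have h := (GaussianFourier.integrable_cexp_neg_mul_sq_norm_add (b := 1) (by simp) 2 ξ).norm
  refine h.congr (ae_of_all _ fun x => ?_)
  simp only [Complex.norm_exp]
  rw [← Real.exp_add, ← Real.exp_nat_mul]
  congr 1
  norm_cast
  simp
  ring

/-- Products of two square integrable functions are integrable, and `exp |s| ≤ exp s + exp (-s)`. -/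
theorem integrable_exp_abs_inner_mul_gaussian_mul (ξ : EuclideanSpace ℝ (Fin n)) (g : L2 n) :
    Integrable fun x : EuclideanSpace ℝ (Fin n) =>
      Real.exp |⟪ξ, x⟫| * Real.exp (-(‖x‖ ^ 2 / 2)) * ‖g x‖ := by
  have h1 := (memLp_exp_inner_mul_gaussian ξ).integrable_mul (Lp.memLp g).norm
  have h2 := (memLp_exp_inner_mul_gaussian (-ξ)).integrable_mul (Lp.memLp g).norm
  refine (h1.add h2).mono' ?_ (ae_of_all _ fun x => ?_)
  · have hcont : Continuous fun x : EuclideanSpace ℝ (Fin n) =>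
      Real.exp |⟪ξ, x⟫| * Real.exp (-(‖x‖ ^ 2 / 2)) := by fun_prop
    exact hcont.aestronglyMeasurable.mul (Lp.aestronglyMeasurable g).norm
  · rw [Real.norm_of_nonneg (by positivity)]
    simp only [Pi.add_apply, Pi.mul_apply, inner_neg_left]
    rw [← add_mul, ← add_mul]
    gcongr
    exact Real.exp_abs_le _

/-- A vector orthogonal to all Hermite functions vanishes. -/
theorem eq_zero_of_inner_hermite_eq_zero {g : L2 n}
    (hg : ∀ m : Fin n → ℕ, inner ℂ ((hermite m).toLp 2 volume) g = 0) : g = 0 := by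
  have hspan : ∀ φ ∈ Submodule.span ℂ (Set.range (hermite (n := n))),
      inner ℂ (φ.toLp 2 volume : L2 n) g = 0 := by
    intro φ hφ
    induction hφ using Submodule.span_induction with
    | mem x hx => obtain ⟨m, rfl⟩ := hx; exact hg m
    | zero => exact inner_zero_left _
    | add x y _ _ hx hy => rw [toLp_add, inner_add_left, hx, hy, add_zero]
    | smul c x _ hx => rw [toLp_smul, inner_smul_left, hx, mul_zero]
  -- The moments of `h` are inner products of `g` with powers of linear forms times the Gaussian,
  -- all in the Hermite span.
  let h : EuclideanSpace ℝ (Fin n) → ℂ := fun x => gaussian _ x * g x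
  have hmoment : ∀ (ξ : EuclideanSpace ℝ (Fin n)) (k : ℕ),
      ∫ x, ((⟪ξ, x⟫ : ℝ) : ℂ) ^ k * h x = 0 := by
    intro ξ k
    obtain ⟨φ, hφ, hφx⟩ := exists_mem_span_eq_inner_pow_mul_gaussian ξ k
    rw [← hspan φ hφ, L2.inner_def]
    refine integral_congr_ae ?_
    filter_upwards [φ.coeFn_toLp 2 volume] with x hx
    rw [hx, hφx, RCLike.inner_apply]
    simp [h, ← Complex.ofReal_pow, -Complex.ofReal_exp]
    ring
  have hmeas : AEStronglyMeasurable h volume :=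
    (gaussian _).continuous.aestronglyMeasurable.mul (Lp.aestronglyMeasurable g)
  have hnorm : ∀ x, ‖h x‖ = Real.exp (-(‖x‖ ^ 2 / 2)) * ‖g x‖ := by
    intro x
    simp only [h, norm_mul, gaussian_apply, Complex.norm_real, Real.norm_eq_abs, Real.abs_exp]
  have hint : Integrable h := by
    have := integrable_exp_abs_inner_mul_gaussian_mul 0 g
    refine this.mono' hmeas (ae_of_all _ fun x => ?_)
    rw [hnorm]
    simp
  have hF : ∀ w, 𝓕 h w = 0 := fourier_eq_zero_of_moments_eq_zero hmeas (fun ξ => by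
    refine (integrable_exp_abs_inner_mul_gaussian_mul ξ g).congr (ae_of_all _ fun x => ?_)
    simp only [hnorm, mul_assoc]) hmoment
  have hae := ae_eq_zero_of_fourier_eq_zero hint hF
  rw [Lp.eq_zero_iff_ae_eq_zero]
  filter_upwards [hae] with x hx
  have : gaussian (EuclideanSpace ℝ (Fin n)) x ≠ 0 := by
    rw [gaussian_apply]
    exact_mod_cast (Real.exp_pos _).ne'
  exact (mul_eq_zero.mp hx).resolve_left this

theorem orthogonal_span_hermiteFun :
    (Submodule.span ℂ (Set.range fun m : Fin n → ℕ => ((hermiteFun m).toLp 2 volume : L2 n)))ᗮ =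
      ⊥ := by
  rw [Submodule.eq_bot_iff]
  intro g hg
  refine eq_zero_of_inner_hermite_eq_zero fun m => ?_
  have h := (Submodule.mem_orthogonal _ _).mp hg _ (Submodule.subset_span ⟨m, rfl⟩)
  simp only [hermiteFun, toLp_smul, inner_smul_left] at h
  refine (mul_eq_zero.mp h).resolve_left ?_
  simpa using toLp_hermite_ne_zero m

/-- The Hilbert basis of Hermite functions. -/
def hermiteBasis (n : ℕ) : HilbertBasis (Fin n → ℕ) ℂ (L2 n) :=
  HilbertBasis.mkOfOrthogonalEqBot orthonormal_hermiteFun orthogonal_span_hermiteFun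

theorem hermiteBasis_apply (m : Fin n → ℕ) :
    hermiteBasis n m = (hermiteFun m).toLp 2 volume := by
  simp [hermiteBasis]

/-! ### The number operators as quantizations -/

/-- Finite Hermite sums are Schwartz functions and converge in the graph of the diagonal operator.
Conversely, symmetry of `number j` places its graph in that of the diagonal operator, which is
closed. -/
theorem isClosureOf_number (j : Fin n) :
    IsClosureOf (diagOp (hermiteBasis n) fun m => (m j : ℝ)) (number j) := by
  apply Set.Subset.antisymm
  · rintro ⟨ψ, χ⟩ hp
    have hp' := (mem_graph_diagOp _ _ _).mp hp
    have h1 := (hermiteBasis n).hasSum_repr ψ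
    have h2 := (hermiteBasis n).hasSum_repr χ
    refine mem_closure_of_tendsto (h1.prodMk_nhds h2) (Filter.Eventually.of_forall fun s => ?_)
    refine ⟨∑ m ∈ s, (hermiteBasis n).repr ψ m • hermiteFun m, ?_⟩
    have e : ∀ c : (Fin n → ℕ) → ℂ, (∑ m ∈ s, c m • hermiteFun m).toLp 2 volume =
        (∑ m ∈ s, c m • hermiteBasis n m : L2 n) := by
      intro c
      change SchwartzMap.toLpCLM ℂ ℂ 2 volume _ = _
      rw [map_sum]
      simp only [map_smul, hermiteBasis_apply]
      rfl
    dsimp only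
    rw [map_sum]
    simp only [map_smul, number_hermiteFun, smul_smul, e]
    simp only [hp']
    congr 1
    refine Finset.sum_congr rfl fun m _ => ?_
    rw [mul_comm]
    simp
  · refine closure_minimal ?_ (isSelfAdjoint_diagOp _ _).isClosed
    rintro _ ⟨φ, rfl⟩
    refine (mem_graph_diagOp _ _ _).mpr fun m => ?_
    dsimp only
    rw [HilbertBasis.repr_apply_apply, HilbertBasis.repr_apply_apply, hermiteBasis_apply,
      ← inner_number, number_hermiteFun, toLp_smul, inner_smul_left]
    simp

end Completeness

/-! ### Weyl quantization of the number operators -/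

section Weyl

variable {n : ℕ}

theorem weyl_eq_sum {q : MvPolynomial (Fin n ⊕ Fin n) ℝ} {t : Finset ((Fin n ⊕ Fin n) →₀ ℕ)}
    (ht : q.support ⊆ t) :
    weyl q = ∑ s ∈ t, ((q.coeff s : ℝ) : ℂ) • weylMonomial s := by
  refine Finset.sum_subset ht fun s _ hs => ?_
  rw [MvPolynomial.notMem_support_iff.mp hs]
  simp

theorem weyl_add (p q : MvPolynomial (Fin n ⊕ Fin n) ℝ) : weyl (p + q) = weyl p + weyl q := by
  classical
  rw [weyl_eq_sum (MvPolynomial.support_add (p := p) (q := q)),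
    weyl_eq_sum (Finset.subset_union_left (s₁ := p.support) (s₂ := q.support)),
    weyl_eq_sum (Finset.subset_union_right (s₁ := p.support) (s₂ := q.support)),
    ← Finset.sum_add_distrib]
  simp [add_smul]

theorem weyl_monomial (s : (Fin n ⊕ Fin n) →₀ ℕ) (c : ℝ) :
    weyl (MvPolynomial.monomial s c) = (c : ℂ) • weylMonomial s := by
  classical
  rw [weyl_eq_sum (MvPolynomial.support_monomial_subset (s := s) (a := c))]
  simp

/-- With a single variable all `k!` orderings give the same product; the number operators need no
other monomials. -/
theorem weylMonomial_single (i : Fin n ⊕ Fin n) (k : ℕ) :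
    weylMonomial (Finsupp.single i k) = Sum.elim position momentum i ^ k := by
  have hl : (Finsupp.toMultiset (Finsupp.single i k)).toList = List.replicate k i := by
    rw [Finsupp.toMultiset_single, Multiset.nsmul_singleton]
    refine List.eq_replicate_iff.mpr ⟨by simp, fun x hx => ?_⟩
    exact Multiset.eq_of_mem_replicate (Multiset.mem_toList.mp hx)
  have hp : ∀ l ∈ (List.replicate k i).permutations,
      (l.map (Sum.elim position momentum)).prod = Sum.elim position momentum i ^ k := by
    intro l hl
    rw [List.perm_replicate.mp (List.mem_permutations.mp hl)]
    simp
  rw [weylMonomial]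
  simp only [hl]
  rw [List.map_congr_left hp, List.map_const', List.sum_replicate, List.length_permutations,
    List.length_replicate, ← Nat.cast_smul_eq_nsmul ℂ, smul_smul,
    inv_mul_cancel₀ (by exact_mod_cast k.factorial_ne_zero), one_smul]

/-- The classical symbol `(x_j² + p_j² - 1) / 2` of the number operator. -/
def numberSymbol (j : Fin n) : MvPolynomial (Fin n ⊕ Fin n) ℝ :=
  MvPolynomial.monomial (Finsupp.single (Sum.inl j) 2) 2⁻¹ +
    MvPolynomial.monomial (Finsupp.single (Sum.inr j) 2) 2⁻¹ +
      -- A constant, since the exponent is zero; in this form `weylMonomial_single` covers it too.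
      MvPolynomial.monomial (Finsupp.single (Sum.inl j) 0) (-2⁻¹)

theorem weyl_numberSymbol (j : Fin n) : weyl (numberSymbol j) = number j := by
  have h := two_smul_number (n := n) j
  rw [numberSymbol, weyl_add, weyl_add, weyl_monomial, weyl_monomial, weyl_monomial,
    weylMonomial_single, weylMonomial_single, weylMonomial_single, pow_zero]
  have h2 : number (n := n) j = (2⁻¹ : ℂ) • (2 : ℂ) • number j := by
    rw [smul_smul]
    norm_num
  rw [h2, h]
  simp only [Sum.elim_inl, Sum.elim_inr]
  push_cast
  module

theorem eval_numberSymbol (j : Fin n) (z : Phase n) :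
    MvPolynomial.eval z (numberSymbol j) =
      2⁻¹ * z (Sum.inl j) ^ 2 + 2⁻¹ * z (Sum.inr j) ^ 2 - 2⁻¹ := by
  simp [numberSymbol, MvPolynomial.eval_monomial, sub_eq_add_neg]

theorem isQuantization_number (j : Fin n) :
    IsQuantization (fun z => MvPolynomial.eval z (numberSymbol j))
      (diagOp (hermiteBasis n) fun m => (m j : ℝ)) :=
  IsQuantization.polynomial _ _ (isSelfAdjoint_diagOp _ _)
    (weyl_numberSymbol j ▸ isClosureOf_number j)

end Weyl

/-! ### The classical system -/

section Classical

variable {n : ℕ}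

theorem hasFDerivAt_numberSymbol (j : Fin n) (z : Phase n) :
    HasFDerivAt (fun z => MvPolynomial.eval z (numberSymbol j))
      (z (Sum.inl j) •
          ContinuousLinearMap.proj (R := ℝ) (φ := fun _ : Fin n ⊕ Fin n => ℝ) (Sum.inl j) +
        z (Sum.inr j) •
          ContinuousLinearMap.proj (R := ℝ) (φ := fun _ : Fin n ⊕ Fin n => ℝ) (Sum.inr j)) z := by
  simp only [eval_numberSymbol]
  have h1 := ((hasFDerivAt_apply (𝕜 := ℝ) (Sum.inl j : Fin n ⊕ Fin n) z).pow 2).const_mul (2⁻¹ : ℝ)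
  have h2 := ((hasFDerivAt_apply (𝕜 := ℝ) (Sum.inr j : Fin n ⊕ Fin n) z).pow 2).const_mul (2⁻¹ : ℝ)
  convert! (h1.add h2).sub_const (2⁻¹ : ℝ) using 1
  ext v
  simp
  ring

theorem contDiff_numberSymbol (j : Fin n) :
    ContDiff ℝ ∞ fun z : Phase n => MvPolynomial.eval z (numberSymbol j) := by
  simp only [eval_numberSymbol]
  fun_prop

/-- Only the `i`-th summand survives, and it is `∂_i f` times `x_i p_i - p_i x_i`. Coordinate
functions `f` give the involution of the symbols. -/
theorem poisson_comp_numberSymbol {f : (Fin n → ℝ) → ℝ} (hf : Differentiable ℝ f) (i : Fin n)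
    (z : Phase n) :
    poisson (fun z => f fun j => MvPolynomial.eval z (numberSymbol j))
      (fun z => MvPolynomial.eval z (numberSymbol i)) z = 0 := by
  have h1 := hasFDerivAt_pi.mpr fun j => hasFDerivAt_numberSymbol (n := n) j z
  have h2 := (hf _).hasFDerivAt.comp z h1
  refine Finset.sum_eq_zero fun j _ => ?_
  have e1 : ∀ v, fderiv ℝ (fun z => f fun j => MvPolynomial.eval z (numberSymbol j)) z v =
      fderiv ℝ f (fun j => MvPolynomial.eval z (numberSymbol j))
        (fun k => z (Sum.inl k) * v (Sum.inl k) + z (Sum.inr k) * v (Sum.inr k)) := by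
    intro v
    exact congrArg (fun L => L v) h2.fderiv
  rw [e1, e1, (hasFDerivAt_numberSymbol i z).fderiv]
  have e2 : (fun k => z (Sum.inl k) * (Pi.single (Sum.inl j) 1 : Phase n) (Sum.inl k) +
      z (Sum.inr k) * (Pi.single (Sum.inl j) 1 : Phase n) (Sum.inr k)) =
      z (Sum.inl j) • (Pi.single j 1 : Fin n → ℝ) := by
    ext k
    by_cases hk : k = j
    · subst hk; simp
    · simp [hk]
  have e3 : (fun k => z (Sum.inl k) * (Pi.single (Sum.inr j) 1 : Phase n) (Sum.inl k) +
      z (Sum.inr k) * (Pi.single (Sum.inr j) 1 : Phase n) (Sum.inr k)) =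
      z (Sum.inr j) • (Pi.single j 1 : Fin n → ℝ) := by
    ext k
    by_cases hk : k = j
    · subst hk; simp
    · simp [hk]
  rw [e2, e3, map_smul, map_smul]
  by_cases hij : i = j
  · subst hij
    simp
    ring
  · simp [hij]

/-- The differentials `x_i dx_i + p_i dp_i` are independent wherever no coordinate vanishes. -/
theorem dense_linearIndependent_fderiv_numberSymbol :
    Dense {z : Phase n | LinearIndependent ℝ
      fun i => fderiv ℝ (fun z => MvPolynomial.eval z (numberSymbol i)) z} := by
  have hd : Dense (Set.pi Set.univ fun _ : Fin n ⊕ Fin n => ({0}ᶜ : Set ℝ)) :=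
    dense_pi _ fun _ _ => dense_compl_singleton 0
  refine hd.mono fun z hz => ?_
  rw [Set.mem_ofPred_eq, Fintype.linearIndependent_iff]
  intro g hg i
  have h := congrArg (fun L : Phase n →L[ℝ] ℝ => L (Pi.single (Sum.inl i) 1)) hg
  simp only [(hasFDerivAt_numberSymbol _ z).fderiv] at h
  have hzi : z (Sum.inl i) ≠ 0 := hz (Sum.inl i) (Set.mem_univ _)
  simpa [Pi.single_apply, hzi] using h

theorem isLiouvilleIntegrable_comp_numberSymbol {f : (Fin n → ℝ) → ℝ} (hf : ContDiff ℝ ∞ f) :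
    IsLiouvilleIntegrable (fun z => f fun j => MvPolynomial.eval z (numberSymbol j))
      (fun i z => MvPolynomial.eval z (numberSymbol (n := n) i)) where
  smooth_hamiltonian := hf.comp (contDiff_pi.mpr contDiff_numberSymbol)
  smooth := contDiff_numberSymbol
  first_integral i z := poisson_comp_numberSymbol (hf.differentiable (by simp)) i z
  involution i j z := poisson_comp_numberSymbol (f := fun y => y i) (differentiable_apply i) j z
  independent := dense_linearIndependent_fderiv_numberSymbol

open scoped Manifold in
/-- Every function on the lattice `ℕⁿ` is the restriction of a smooth function. -/
theorem exists_contDiff_interpolation (l : (Fin n → ℕ) → ℝ) :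
    ∃ f : (Fin n → ℝ) → ℝ, ContDiff ℝ ∞ f ∧ ∀ m : Fin n → ℕ, f (fun j => (m j : ℝ)) = l m := by
  let t : (Fin n → ℝ) → Set ℝ := fun y => {c | ∀ m : Fin n → ℕ, (fun j => (m j : ℝ)) = y → c = l m}
  have ht : ∀ y, Convex ℝ (t y) := by
    intro y
    have : t y = ⋂ (m : Fin n → ℕ) (_ : (fun j => (m j : ℝ)) = y), {l m} := by
      ext c
      simp [t]
    rw [this]
    exact convex_iInter fun m => convex_iInter fun _ => convex_singleton _
  have hloc : ∀ x, ∃ c, ∀ᶠ y in nhds x, c ∈ t y := by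
    intro x
    -- Lattice points are at sup-distance at least `1`, so a ball of radius `1/2` contains at most
    -- one and a constant solves the problem locally.
    have huniq : ∀ m m' : Fin n → ℕ, dist (fun j => (m j : ℝ)) x < 1 / 2 →
        dist (fun j => (m' j : ℝ)) x < 1 / 2 → m = m' := by
      intro m m' hm hm'
      ext j
      have h1 := (dist_le_pi_dist (fun j => (m j : ℝ)) x j).trans_lt hm
      have h2 := (dist_le_pi_dist (fun j => (m' j : ℝ)) x j).trans_lt hm'
      rw [Real.dist_eq, abs_lt] at h1 h2
      have h3 : (m j : ℝ) < m' j + 1 := by linarith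
      have h4 : (m' j : ℝ) < m j + 1 := by linarith
      have h5 : m j < m' j + 1 := by exact_mod_cast h3
      have h6 : m' j < m j + 1 := by exact_mod_cast h4
      omega
    by_cases hex : ∃ m : Fin n → ℕ, dist (fun j => (m j : ℝ)) x < 1 / 2
    · obtain ⟨m, hm⟩ := hex
      refine ⟨l m, ?_⟩
      filter_upwards [Metric.ball_mem_nhds x (by norm_num : (0 : ℝ) < 1 / 2)] with y hy m' hm'
      rw [huniq m m' hm (by rw [hm']; exact hy)]
    · refine ⟨0, ?_⟩
      filter_upwards [Metric.ball_mem_nhds x (by norm_num : (0 : ℝ) < 1 / 2)] with y hy m' hm'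
      exact absurd ⟨m', by rw [hm']; exact hy⟩ hex
  -- A smooth partition of unity glues the local constants, the constraint sets `t y` being convex.
  obtain ⟨g, hg⟩ := exists_contMDiffMap_forall_mem_convex_of_local_const (n := ⊤)
    𝓘(ℝ, Fin n → ℝ) ht hloc
  exact ⟨g, g.contMDiff.contDiff, fun m => hg _ m rfl⟩

end Classical

/-! ### Functional independence -/

section Independence

variable {ℋ : Type*} [NormedAddCommGroup ℋ] [InnerProductSpace ℂ ℋ] [CompleteSpace ℋ]
variable {α : Type*} [MeasurableSpace α]

instance (E : PVM α ℋ) (ψ : ℋ) : IsFiniteMeasure (E.measure ψ) :=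
  ⟨by rw [E.measure_apply ψ MeasurableSet.univ]; exact ENNReal.ofReal_lt_top⟩

theorem PVM.measure_proj (E : PVM α ℋ) (ψ : ℋ) {s : Set α} (hs : MeasurableSet s) :
    E.measure (E.proj s ψ) = (E.measure ψ).restrict s := by
  ext t ht
  rw [Measure.restrict_apply ht, E.measure_apply _ ht, E.measure_apply _ (ht.inter hs),
    E.proj_inter t s ht hs]
  rfl

theorem PVM.proj_add_proj_compl (E : PVM α ℋ) (ψ : ℋ) {s : Set α} (hs : MeasurableSet s) :
    E.proj s ψ + E.proj sᶜ ψ = ψ := by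
  let u : ℕ → Set α := fun i => if i = 0 then s else if i = 1 then sᶜ else ∅
  have hu : ∀ i, MeasurableSet (u i) := by
    intro i
    simp only [u]
    split_ifs
    exacts [hs, hs.compl, MeasurableSet.empty]
  have hd : Pairwise (Function.onFun Disjoint u) := by
    intro i j hij
    simp only [Function.onFun, u]
    split_ifs <;> first | omega | simp [disjoint_compl_right, disjoint_compl_left]
  have hU : ⋃ i, u i = Set.univ := by
    rw [Set.eq_univ_iff_forall]
    intro x
    by_cases hx : x ∈ s
    · exact Set.mem_iUnion.mpr ⟨0, by simpa [u] using hx⟩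
    · exact Set.mem_iUnion.mpr ⟨1, by simpa [u] using hx⟩
  have h1 := E.hasSum_iUnion u hu hd ψ
  rw [hU, E.proj_univ] at h1
  have h2 : HasSum (fun i => E.proj (u i) ψ) (∑ i ∈ Finset.range 2, E.proj (u i) ψ) := by
    refine hasSum_sum_of_ne_finset_zero fun i hi => ?_
    have h0 : i ≠ 0 := by rintro rfl; simp at hi
    have h1 : i ≠ 1 := by rintro rfl; simp at hi
    simp [u, h0, h1, E.proj_empty]
  have h3 := h2.unique h1
  simpa [Finset.sum_range_succ, u] using h3

theorem PVM.inner_proj_proj_of_disjoint (E : PVM α ℋ) (ψ φ : ℋ) {s t : Set α}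
    (hs : MeasurableSet s) (ht : MeasurableSet t) (hst : Disjoint s t) :
    inner ℂ (E.proj s ψ) (E.proj t φ) = 0 := by
  have h := (ContinuousLinearMap.isSelfAdjoint_iff_isSymmetric.mp
    (E.isStarProjection s hs).isSelfAdjoint) ψ (E.proj t φ)
  have h2 : E.proj s (E.proj t φ) = 0 := by
    have := congrArg (fun T : ℋ →L[ℂ] ℋ => T φ) (E.proj_inter s t hs ht)
    rw [hst.inter_eq, E.proj_empty] at this
    exact this.symm
  exact h.trans (by rw [ContinuousLinearMap.coe_coe, h2, inner_zero_right])

/-- Changing the phase of a vector on a part of the spectrum preserves its spectral measure. -/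
theorem PVM.measure_proj_add_smul_proj_compl (E : PVM α ℋ) (ψ : ℋ) {s : Set α}
    (hs : MeasurableSet s) {z : ℂ} (hz : ‖z‖ = 1) :
    E.measure (E.proj s ψ + z • E.proj sᶜ ψ) = E.measure ψ := by
  have key : ∀ w : ℂ, ‖w‖ = 1 → ∀ t, MeasurableSet t →
      ‖E.proj t (E.proj s ψ + w • E.proj sᶜ ψ)‖ ^ 2 =
        ‖E.proj (t ∩ s) ψ‖ ^ 2 + ‖E.proj (t ∩ sᶜ) ψ‖ ^ 2 := by
    intro w hw t ht
    have e1 : E.proj t (E.proj s ψ) = E.proj (t ∩ s) ψ := by rw [E.proj_inter t s ht hs]; rfl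
    have e2 : E.proj t (E.proj sᶜ ψ) = E.proj (t ∩ sᶜ) ψ := by
      rw [E.proj_inter t sᶜ ht hs.compl]; rfl
    have h0 : inner ℂ (E.proj (t ∩ s) ψ) (w • E.proj (t ∩ sᶜ) ψ) = 0 := by
      rw [inner_smul_right, E.inner_proj_proj_of_disjoint ψ ψ (ht.inter hs) (ht.inter hs.compl)
        (disjoint_compl_right.mono Set.inter_subset_right Set.inter_subset_right), mul_zero]
    rw [map_add, map_smul, e1, e2, sq, sq, sq,
      norm_add_sq_eq_norm_sq_add_norm_sq_of_inner_eq_zero _ _ h0, norm_smul, hw, one_mul]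
  ext t ht
  rw [E.measure_apply _ ht, E.measure_apply _ ht, key z hz t ht, ← key 1 (by simp) t ht, one_smul,
    E.proj_add_proj_compl ψ hs]

/-- The spectral measure of an eigenvector of `∫ f dE` is concentrated where `f` is equal to the
eigenvalue. -/
theorem PVM.IsIntegral.ae_eq_of_eigenvector {E : PVM α ℋ} {f : α → ℝ} {B : ℋ →ₗ.[ℂ] ℋ}
    (h : E.IsIntegral f B) (hf : Measurable f) {ψ : ℋ} {c : ℝ}
    (hψ : (ψ, (c : ℂ) • ψ) ∈ B.graph) : ∀ᵐ x ∂E.measure ψ, f x = c := by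
  obtain ⟨hdom, hval⟩ := h
  have hψd : ψ ∈ B.domain := LinearPMap.mem_domain_of_mem_graph hψ
  have hBψ : B ⟨ψ, hψd⟩ = (c : ℂ) • ψ := by
    obtain ⟨ψ', h1, h2⟩ := (LinearPMap.mem_graph_iff _).mp hψ
    have : ψ' = ⟨ψ, hψd⟩ := Subtype.ext h1
    rw [← this]
    exact h2
  have hsq := (hdom ψ).mp hψd
  have hint : Integrable f (E.measure ψ) :=
    ((memLp_two_iff_integrable_sq hf.aestronglyMeasurable).mpr hsq).integrable (by norm_num)
  -- It suffices to show that `⟨E(s)ψ, B E(s)ψ⟩`, which is the integral of `f` over `s`, equals `c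
  -- ‖E(s)ψ‖²`.
  refine hint.ae_eq_of_forall_setIntegral_eq _ (fun _ => c) (integrable_const c) ?_
  intro s hs _
  have hmem : ∀ s, MeasurableSet s → E.proj s ψ ∈ B.domain := by
    intro s hs
    rw [hdom, E.measure_proj ψ hs]
    exact hsq.restrict
  let φ : B.domain := ⟨E.proj s ψ, hmem s hs⟩
  let χ : B.domain := ⟨E.proj sᶜ ψ, hmem sᶜ hs.compl⟩
  have hsum : B φ + B χ = (c : ℂ) • ψ := by
    rw [← LinearPMap.map_add, ← hBψ]
    congr 1
    exact Subtype.ext (E.proj_add_proj_compl ψ hs)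
  have hz : ∀ z : ℂ, ‖z‖ = 1 →
      inner ℂ ((φ : ℋ) + z • (χ : ℋ)) (B φ + z • B χ) = ((∫ x, f x ∂E.measure ψ : ℝ) : ℂ) := by
    intro z hz
    have h1 := hval (φ + z • χ)
    rw [LinearPMap.map_add, LinearPMap.map_smul] at h1
    refine h1.trans ?_
    exact congrArg (fun μ => ((∫ x, f x ∂μ : ℝ) : ℂ)) (E.measure_proj_add_smul_proj_compl ψ hs hz)
  -- `IsIntegral` gives only quadratic form values. As `φ + z χ` has the same spectral measure for
  -- all unimodular `z`, comparing `z = ±1, ±i` removes the cross terms.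
  have hcross : inner ℂ (φ : ℋ) (B χ) = 0 := by
    have h1 := hz 1 (by simp)
    have h2 := hz (-1) (by simp)
    have h3 := hz Complex.I (by simp)
    have h4 := hz (-Complex.I) (by simp)
    simp only [inner_add_left, inner_add_right, inner_smul_left, inner_smul_right, map_neg, map_one,
      Complex.conj_I] at h1 h2 h3 h4
    have h5 : Complex.I * Complex.I = -1 := Complex.I_mul_I
    linear_combination (1 / 4 : ℂ) * h1 - (1 / 4 : ℂ) * h2 - (Complex.I / 4) * h3 +
      (Complex.I / 4) * h4 +
        ((inner ℂ (φ : ℋ) (B χ) - inner ℂ (χ : ℋ) (B φ)) / 2) * h5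
  have hφ : inner ℂ (φ : ℋ) (B φ) = ((c * ‖E.proj s ψ‖ ^ 2 : ℝ) : ℂ) := by
    have h1 : inner ℂ (φ : ℋ) (B φ) = inner ℂ (φ : ℋ) ((c : ℂ) • ψ) := by
      rw [← hsum, inner_add_right, hcross, add_zero]
    have h2 : inner ℂ (E.proj s ψ) ψ = ((‖E.proj s ψ‖ ^ 2 : ℝ) : ℂ) := by
      have h3 : inner ℂ (E.proj s ψ) ψ = inner ℂ (E.proj s ψ) (E.proj s ψ + E.proj sᶜ ψ) := by
        rw [E.proj_add_proj_compl ψ hs]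
      rw [h3, inner_add_right, E.inner_proj_proj_of_disjoint ψ ψ hs hs.compl disjoint_compl_right,
        add_zero, inner_self_eq_norm_sq_to_K]
      norm_cast
    rw [h1, inner_smul_right, h2]
    push_cast
    rfl
  rw [setIntegral_const, measureReal_def, E.measure_apply ψ hs,
    ENNReal.toReal_ofReal (by positivity), ← E.measure_proj ψ hs]
  have h1 := hval φ
  rw [hφ] at h1
  have h2 := Complex.ofReal_injective h1
  rw [smul_eq_mul, mul_comm, h2]

/-- For any joint resolution `E` of the other operators, the spectral measure of `b m` sits at
`(m_j)_{j ≠ i}`, forcing `f` to be `m_i` there. The indices `0` and `Pi.single i 1` share this point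
but have different `m_i`. -/
theorem functionallyIndependent_diagOp {n : ℕ} (b : HilbertBasis (Fin n → ℕ) ℂ ℋ) :
    FunctionallyIndependent fun j : Fin n => diagOp b fun m => (m j : ℝ) := by
  rintro i ⟨E, hE, f, hf, hfi⟩
  have key : ∀ m : Fin n → ℕ, f (fun j : {j // j ≠ i} => (m j : ℝ)) = m i := by
    intro m
    have hg := basis_mem_graph_diagOp b (fun m => (m i : ℝ)) m
    have h1 : ∀ᵐ x ∂E.measure (b m), ∀ j : {j // j ≠ i}, x j = (m j : ℝ) :=
      ae_all_iff.mpr fun j => (hE j).ae_eq_of_eigenvector (measurable_pi_apply j)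
        (basis_mem_graph_diagOp b (fun m => (m j : ℝ)) m)
    have h2 := hfi.ae_eq_of_eigenvector hf hg
    have hne : (MeasureTheory.ae (E.measure (b m))).NeBot := by
      rw [ae_neBot]
      intro h0
      have h3 := E.measure_apply (b m) MeasurableSet.univ
      rw [h0, E.proj_univ] at h3
      simp [b.orthonormal.norm_eq_one m] at h3
    obtain ⟨x, hx1, hx2⟩ := (h1.and h2).exists
    rw [← hx2]
    congr 1
    ext j
    exact (hx1 j).symm
  have h0 := key 0
  have h1 := key (Pi.single i 1)
  have e : (fun j : {j // j ≠ i} => (((Pi.single i 1 : Fin n → ℕ) j : ℕ) : ℝ)) =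
      fun j : {j // j ≠ i} => (((0 : Fin n → ℕ) j : ℕ) : ℝ) := by
    ext j
    simp [j.2]
  rw [e, h0] at h1
  simp at h1

theorem areFirstIntegrals_diagOp {n : ℕ} (b : HilbertBasis (Fin n → ℕ) ℂ ℋ)
    (l : (Fin n → ℕ) → ℝ) :
    AreFirstIntegrals (diagOp b l) fun j : Fin n => diagOp b fun m => (m j : ℝ) where
  selfAdjoint _ := isSelfAdjoint_diagOp b _
  commute _ _ := stronglyCommute_diagOp b _ _
  commute_hamiltonian _ := stronglyCommute_diagOp b _ _
  independent := functionallyIndependent_diagOp b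

end Independence

/-! ### Integrability -/

section Integrability

variable {ℋ : Type*} [NormedAddCommGroup ℋ] [InnerProductSpace ℂ ℋ]

/-- Distinct basis vectors are at distance at least `1`, and a discrete subset of a separable metric
space is countable. -/
theorem countable_of_hilbertBasis [TopologicalSpace.SeparableSpace ℋ] {ι : Type*}
    (b : HilbertBasis ι ℂ ℋ) : Countable ι := by
  have := UniformSpace.secondCountable_of_separable ℋ
  have hdist : ∀ i j, i ≠ j → 1 ≤ dist (b i) (b j) := by
    intro i j hij
    have h := norm_sub_sq (𝕜 := ℂ) (b i) (b j)
    rw [b.orthonormal.inner_eq_zero hij, b.orthonormal.norm_eq_one, b.orthonormal.norm_eq_one,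
      map_zero] at h
    rw [dist_eq_norm]
    nlinarith [norm_nonneg (b i - b j)]
  have hd : DiscreteTopology (Set.range b) := by
    refine DiscreteTopology.of_forall_le_dist one_pos ?_
    rintro ⟨_, i, rfl⟩ ⟨_, j, rfl⟩ hij
    exact hdist i j fun h => hij (Subtype.ext (congrArg b h))
  have hc : Countable (Set.range b) :=
    TopologicalSpace.separableSpace_iff_countable.mp inferInstance
  refine (Equiv.ofInjective b ?_).countable_iff.mpr hc
  intro i j hij
  by_contra hne
  have := hdist i j hne
  rw [hij, dist_self] at this
  norm_num at this

theorem infinite_of_hilbertBasis (hℋ : ¬ FiniteDimensional ℂ ℋ) {ι : Type*}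
    (b : HilbertBasis ι ℂ ℋ) : Infinite ι := by
  by_contra h
  rw [not_infinite_iff_finite] at h
  have := Fintype.ofFinite ι
  exact hℋ (Module.Finite.of_basis b.toOrthonormalBasis.toBasis)

variable [CompleteSpace ℋ]

theorem isQuantization_comp_numberSymbol {n : ℕ} {f : (Fin n → ℝ) → ℝ} (hf : ContDiff ℝ ∞ f) :
    IsQuantization (fun z => f fun j => MvPolynomial.eval z (numberSymbol j))
      (diagOp (hermiteBasis n) fun m => f fun j => (m j : ℝ)) := by
  let E : PVM (Fin n → ℝ) (L2 n) := diagPVM (hermiteBasis n) fun m j => (m j : ℝ)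
  have hE : IsJointSpectralResolution E fun j => diagOp (hermiteBasis n) fun m => (m j : ℝ) :=
    fun j => isIntegral_diagPVM (hermiteBasis n) (fun m j => (m j : ℝ)) fun x => x j
  have hA : E.IsIntegral f (diagOp (hermiteBasis n) fun m => f fun j => (m j : ℝ)) :=
    isIntegral_diagPVM (hermiteBasis n) (fun m j => (m j : ℝ)) f
  exact IsQuantization.calculus (fun j z => MvPolynomial.eval z (numberSymbol j)) _
    isQuantization_number E hE f hf _ hA

theorem isIntegrableWith_diagOp {n : ℕ} (b : HilbertBasis (Fin n → ℕ) ℂ ℋ)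
    (l : (Fin n → ℕ) → ℝ) :
    IsIntegrableWith n (diagOp b l) fun j : Fin n => diagOp b fun m => (m j : ℝ) := by
  obtain ⟨f, hf, hfl⟩ := exists_contDiff_interpolation l
  have hl : l = fun m => f fun j => (m j : ℝ) := funext fun m => (hfl m).symm
  have hA : IsQuantization (fun z => f fun j => MvPolynomial.eval z (numberSymbol j))
      (diagOp (hermiteBasis n) l) := by
    rw [hl]
    exact isQuantization_comp_numberSymbol hf
  exact ⟨areFirstIntegrals_diagOp b l, b.repr.trans (hermiteBasis n).repr.symm,
    diagOp (hermiteBasis n) l, fun j => diagOp (hermiteBasis n) fun m => (m j : ℝ), _, _,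
    isSelfAdjoint_diagOp _ _, intertwines_diagOp b _ l, fun j => intertwines_diagOp b _ _,
    areFirstIntegrals_diagOp _ l, hA, isQuantization_number,
    isLiouvilleIntegrable_comp_numberSymbol hf⟩

/-- A Hilbert basis reindexed along an equivalence. -/
theorem exists_hilbertBasis_reindex {ι κ : Type*} (b : HilbertBasis ι ℂ ℋ) (e : κ ≃ ι) :
    ∃ c : HilbertBasis κ ℂ ℋ, ∀ k, c k = b (e k) := by
  have h : Orthonormal ℂ (b ∘ e) := b.orthonormal.comp e e.injective
  refine ⟨HilbertBasis.mk h ?_, fun k => by rw [HilbertBasis.coe_mk]; rfl⟩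
  rw [e.surjective.range_comp, b.dense_span]

end Integrability

end QuantumIntegrability

end

/-! ### Assembly of the theorem -/

open QuantumIntegrability in
theorem mainTheorem4 {ℋ : Type*} [NormedAddCommGroup ℋ] [InnerProductSpace ℂ ℋ] [CompleteSpace ℋ]
    [TopologicalSpace.SeparableSpace ℋ] (hℋ : ¬ FiniteDimensional ℂ ℋ)
    (n : ℕ) (hn : 1 ≤ n) (H : ℋ →ₗ.[ℂ] ℋ) (hH : IsSelfAdjoint H)
    (hσ : (QuantumIntegrability.spectrum H).Countable) :
    QuantumIntegrability.HasPurePointSpectrum H ∧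
      ∃ T : Fin n → ℋ →ₗ.[ℂ] ℋ, QuantumIntegrability.IsIntegrableWith n H T := by
  obtain ⟨S, b, l, hb⟩ := exists_eigenbasis hH hσ
  have hS : Countable S := countable_of_hilbertBasis b
  have hS' : Infinite S := infinite_of_hilbertBasis hℋ b
  -- Makes `Fin n → ℕ` infinite, so that it is equinumerous with the countably infinite `S`.
  have : NeZero n := ⟨by omega⟩
  obtain ⟨e⟩ := nonempty_equiv_of_countable (α := Fin n → ℕ) (β := S)
  obtain ⟨c, hc⟩ := exists_hilbertBasis_reindex b e
  have hHc : H = diagOp c (l ∘ e) :=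
    eq_diagOp_of_eigenbasis c hH fun m => by rw [hc]; exact hb (e m)
  rw [hHc]
  exact ⟨hasPurePointSpectrum_diagOp c _, _, isIntegrableWith_diagOp c _⟩
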